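/- Let $G$ be a finite simple graph. A proper vertex colouring $f\colon V(G)\to C$ with a finite colour set $C$ is called complete if for any two distinct colours $c_1,c_2\in C$ there is an edge $v_1v_2$ of $G$ with $f(v_1)=c_1$ and $f(v_2)=c_2$. The achromatic number $\operatorname{achr}(G)$ is the maximum cardinality of a set $C$ for which $G$ has a proper complete vertex colouring $f\colon V(G)\to C$. Let $K_6\,\square\,K_7$ be the Cartesian product of the complete graphs on $6$ and on $7$ vertices. Then $$\operatorname{achr}(K_6\,\square\,K_7)=18.$$ -/

import Mathlib

namespace SimpleGraph

/-- A colouring `f : V(G) → C` (a Mathlib `Coloring` is by definition proper) is complete if for any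
two distinct colours there is an edge of `G` whose ends carry these two colours. -/
def Coloring.IsComplete {V : Type*} {G : SimpleGraph V} {C : Type*} (f : G.Coloring C) : Prop :=
  ∀ c₁ c₂ : C, c₁ ≠ c₂ → ∃ v₁ v₂ : V, G.Adj v₁ v₂ ∧ f v₁ = c₁ ∧ f v₂ = c₂

/-- `G` has a proper complete vertex colouring with a colour set of `k` elements. -/
def HasCompleteColoring {V : Type*} (G : SimpleGraph V) (k : ℕ) : Prop :=
  ∃ f : G.Coloring (Fin k), f.IsComplete

/-- The achromatic number: the maximum cardinality of a colour set that admits a proper complete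
vertex colouring of `G`. (By `achromaticNumber_eq_iff`, a positive value is always attained and is
an upper bound, hence a true maximum.) -/
noncomputable def achromaticNumber {V : Type*} (G : SimpleGraph V) : ℕ :=
  sSup {k : ℕ | G.HasCompleteColoring k}

theorem achromaticNumber_eq_iff {V : Type*} (G : SimpleGraph V) {n : ℕ} (hn : n ≠ 0) :
    G.achromaticNumber = n ↔ IsGreatest {k : ℕ | G.HasCompleteColoring k} n := by
  constructor
  · intro h
    have hb : BddAbove {k : ℕ | G.HasCompleteColoring k} := by
      by_contra hb
      exact hn (h.symm.trans (Nat.sSup_of_not_bddAbove hb))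
    have hne : {k : ℕ | G.HasCompleteColoring k}.Nonempty := by
      by_contra hne
      rw [Set.not_nonempty_iff_eq_empty] at hne
      apply hn
      rw [← h, achromaticNumber, hne, csSup_empty]
      rfl
    rw [← h]
    exact ⟨Nat.sSup_mem hne hb, fun k hk => le_csSup hb hk⟩
  · intro h
    exact h.csSup_eq

end SimpleGraph

/-!
# The achromatic number of the Cartesian product of complete graphs on 6 and 7 vertices

The cells of the `6 × 7` grid are the numbers `7 * row + column`. In a complete colouring with at
least 19 colours every colour has two cells or more, and many colours have exactly two. The map that
exchanges the two cells of `d` of these colours, and fixes the cells of the `u` other colours, meets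
the counting constraints of `GridSearch.Sol`; the verified search `GridSearch.run` shows that no map
meets them for the values of `d` and `u` that occur.

A state of the search is a bit matrix, stored in one natural number: bit `43 * (x + 1) + y` says
that `x ↦ y` is still possible, bit `43 * (x + 1) + 42` that the cell `x` is still free. The lowest
43 bits hold a tag that tells states apart.
-/

/-! ### The search program on bit matrices -/

namespace GridSearch
open Nat (land lor xor shiftLeft shiftRight add sub mul div mod beq ble)

/-! The lower bound is an explicit colouring with 18 colours. For the upper bound suppose that there
are at least 19 colours. A colour with a single cell would see only 11 other cells, so every colour
has at least two cells; hence there are at most 21 colours, and since there are 42 cells, at least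
`3 * card - 42` colours have exactly two. Choose `d` of these and let `u` be the number of remaining
colours. The map `π` exchanging the two cells of each chosen colour and fixing all other cells is an
involution.

Take a pair `{x, π x}`. Exactly 20 further cells lie on a row or column through it, and every other
colour must occur among them. The `d - 1` other pairs use at least one of these cells each, so at
most `21 - d` can be excess: fixed cells, or second cells of pairs lying there entirely. At least
`u` fixed cells are needed for the other colours, which leaves at most `21 - d - u` such pairs, and
at most `42 - 2 * d - u` fixed cells elsewhere. These bounds, with at most `u` fixed cells on a
line, form `GridSearch.Sol` (`GridSearch.Arrangement.sol`).

No `π` coming from a colouring survives an exhaustive search, evaluated by the kernel for the three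
cases (`GridSearch.run_sound`). At shallow levels the search uses swaps of rows and columns: once a
pair is refuted, so are its images under swaps that fix the current matrix
(`GridSearch.Avoids.spread`). Below, the counting constraints prune the tree
(`GridSearch.assign_sound`). The choices of cell and order are heuristics and are not verified; only
the exhaustiveness of each branching and the validity of each deletion are. -/

/-- A pair `{p, q}` in use: its masks `np`, `nq`, the number `a` of pairs and fixed cells near it, the
number `b` of pairs near it and the number `c` of fixed cells away from it. -/
structure Rec where
  p : ℕ
  q : ℕ
  np : ℕ
  nq : ℕ
  a : ℕ
  b : ℕ
  c : ℕ

def field : ℕ := 2 ^ 42 - 1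
def tagField : ℕ := 2 ^ 43 - 1
def colBit : ℕ := (2 ^ (43 * 43) - 1) / (2 ^ 43 - 1)
def outerRow : ℕ := (2 ^ 301 - 1) * 2 ^ 43
def outerCol : ℕ := (2 ^ 43 - 1) * ((2 ^ (43 * 42) - 1) / (2 ^ 301 - 1)) * 2 ^ 43
def innerRow : ℕ := 127 * colBit
def innerCol : ℕ := ((2 ^ 42 - 1) / 127) * colBit
def diag : ℕ := ((2 ^ (44 * 42) - 1) / (2 ^ 44 - 1)) * 2 ^ 43
def ones : ℕ := (2 ^ 42 - 1) * ((2 ^ (43 * 42) - 1) / (2 ^ 43 - 1)) * 2 ^ 43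
def flag : ℕ := 2 ^ 42 * ((2 ^ (43 * 42) - 1) / (2 ^ 43 - 1)) * 2 ^ 43
def cand : ℕ := (2 ^ 42 - 1) * colBit

/-- In the bit of `x ↦ y`, outer masks test `x` and inner masks test `y`. Both ask whether the cell
lies on a line through `p` or `q`. -/
def outerMask (p q : ℕ) : ℕ :=
  lor (lor (shiftLeft outerRow (mul 301 (div p 7))) (shiftLeft outerRow (mul 301 (div q 7))))
    (lor (shiftLeft outerCol (mul 43 (mod p 7))) (shiftLeft outerCol (mul 43 (mod q 7))))
def innerMask (p q : ℕ) : ℕ :=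
  lor (lor (shiftLeft innerRow (mul 7 (div p 7))) (shiftLeft innerRow (mul 7 (div q 7))))
    (lor (shiftLeft innerCol (mod p 7)) (shiftLeft innerCol (mod q 7)))
def minus (x y : ℕ) : ℕ := xor x (land x y)
def cellMask (p : ℕ) : ℕ :=
  lor tagField (lor (shiftLeft tagField (mul 43 (add p 1))) (shiftLeft colBit p))
def bitAt (x i : ℕ) : ℕ := land (shiftRight x i) 1
-- A hash of the assignments made so far, by which the search is also split into shares. Soundness
-- needs only that it stays below the matrix bits.
def nextTag (t p q : ℕ) : ℕ := mod (add (mul t 1847) (add (mul 43 p) q)) (2 ^ 41)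
def row (M p : ℕ) : ℕ := land (shiftRight M (mul 43 (add p 1))) field
def isFree (M p : ℕ) : Bool := cond (ble p 41) (beq 1 (bitAt M (add 85 (mul 43 p)))) false

/-- `force x f` is `f x`, but its kernel evaluation starts with `x`. -/
noncomputable def force {α : Type} (x : ℕ) (f : ℕ → α) : α :=
  Nat.rec (f 0) (fun m _ => f (Nat.succ m)) x

noncomputable def sumOver {α : Type} (f : α → ℕ) (l : List α) : ℕ :=
  List.rec 0 (fun x _ ih => add (f x) ih) l

/-- Removes the entries that would exceed a bound on the number of pairs or fixed cells near a pair. -/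
noncomputable def filterA (d u np nq a b M : ℕ) : ℕ :=
  cond (beq a (sub 21 d)) (minus M (land np nq))
    (cond (beq b (sub (sub 21 d) u)) (minus M (minus (land np nq) diag)) M)
/-- Removes the fixed cells that would exceed the bound on fixed cells away from a pair. -/
noncomputable def filterC (d u np c M : ℕ) : ℕ :=
  cond (beq c (sub (sub 42 (mul 2 d)) u)) (lor (minus M diag) (land M np)) M

/-- Updates the pairs in use after the cell `x` is fixed. -/
noncomputable def passFixed (d u x : ℕ) (l : List Rec) : ℕ → (ℕ → List Rec → Bool) → Bool :=
  List.rec (fun M k => k M []) (fun r _ ih M k =>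
    cond (beq (bitAt r.nq x) 0)
      (force (add r.c 1) fun c => force (filterC d u r.np c M) fun M =>
        ih M fun M rs => k M (⟨r.p, r.q, r.np, r.nq, r.a, r.b, c⟩ :: rs))
      (force (add r.a 1) fun a => force (filterA d u r.np r.nq a r.b M) fun M =>
        ih M fun M rs => k M (⟨r.p, r.q, r.np, r.nq, a, r.b, r.c⟩ :: rs))) l

/-- Updates the pairs in use after the pair `{x, y}` is added. -/
noncomputable def passPair (d u x y : ℕ) (l : List Rec) : ℕ → (ℕ → List Rec → Bool) → Bool :=
  List.rec (fun M k => k M []) (fun r _ ih M k =>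
    cond (beq (land (bitAt r.nq x) (bitAt r.nq y)) 0)
      (ih M fun M rs => k M (r :: rs))
      (force (add r.a 1) fun a => force (add r.b 1) fun b =>
        force (filterA d u r.np r.nq a b M) fun M =>
        ih M fun M rs => k M (⟨r.p, r.q, r.np, r.nq, a, b, r.c⟩ :: rs))) l

/-- The record of the new pair `{p, q}`. -/
noncomputable def fresh (us : List ℕ) (ds : List Rec) (p q : ℕ) (k : Rec → Bool) : Bool :=
  force (outerMask p q) fun np => force (innerMask p q) fun nq =>
  force (sumOver (fun r : Rec => land (bitAt nq r.p) (bitAt nq r.q)) ds) fun b =>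
  force (add b (sumOver (fun x => bitAt nq x) us)) fun a =>
  force (sumOver (fun x => sub 1 (bitAt nq x)) us) fun c => k ⟨p, q, np, nq, a, b, c⟩

/-- Removes the fixed cells of a line that holds `u` of them already. -/
noncomputable def lineFilter (u p : ℕ) (us : List ℕ) (M : ℕ) : ℕ :=
  (fun M => cond (beq (sumOver (fun x => cond (beq (mod x 7) (mod p 7)) 1 0) us) u)
    (minus M (land diag (shiftLeft outerCol (mul 43 (mod p 7))))) M)
  (cond (beq (sumOver (fun x => cond (beq (div x 7) (div p 7)) 1 0) us) u)
    (minus M (land diag (shiftLeft outerRow (mul 301 (div p 7))))) M)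

/-- Adds the pair `{p, q}`, or the fixed cell `p` if `p = q`, to a state. -/
noncomputable def assign (d u t M : ℕ) (us : List ℕ) (ds : List Rec) (p q : ℕ)
    (k : ℕ → ℕ → List ℕ → List Rec → Bool) : Bool :=
  force (nextTag t p q) fun t =>
  cond (beq p q)
    (force (lor (minus M (cellMask p)) t) fun M =>
      force (lineFilter u p (p :: us)
        (cond (beq (List.length (p :: us)) (sub 42 (mul 2 d))) (minus M diag) M)) fun M =>
      passFixed d u p ds M fun M ds => k t M (p :: us) ds)
    (fresh us ds p q fun r =>
      cond (ble r.a (sub 21 d)) (cond (ble r.b (sub (sub 21 d) u))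
        (cond (ble r.c (sub (sub 42 (mul 2 d)) u))
          (force (lor (land (minus (minus M (cellMask p)) (cellMask q))
              (lor (lor r.np r.nq) (lor diag flag))) t) fun M =>
            force (filterC d u r.np r.c (filterA d u r.np r.nq r.a r.b M)) fun M =>
            passPair d u p q ds M fun M ds => k t M us (r :: ds))
          true) true) true)

noncomputable def highBit (x : ℕ) : ℕ :=
  (List.rec (fun _ acc => acc) (fun w _ ih x acc =>
    force (shiftRight x w) fun y => cond (beq y 0) (ih x acc) (ih y (add acc w)))
    [32, 16, 8, 4, 2, 1] : ℕ → ℕ → ℕ) x 0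

/-- A cell with few candidates: candidates are deleted in each row of `x` one by one until a row
marked by `F` is empty. It yields 42 if there is none. -/
noncomputable def strip (F : ℕ) (n : ℕ) : ℕ → ℕ :=
  Nat.rec (fun _ => 42) (fun _ ih x =>
    -- Since `43 * (x + 1) + 42 = 44 * (x + 1) + (41 - x)`, reduction modulo `2 ^ 44 - 1` sends the
    -- flag of row `x` to bit `41 - x`. The highest bit then gives the first empty row.
    (fun nz => force (mod (minus F nz) (2 ^ 44 - 1)) fun z =>
      cond (beq z 0) (force (add 1 (land x (sub x (shiftRight nz 42)))) ih) (sub 41 (highBit z)))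
    (land flag (add x ones))) n

noncomputable def allBits (f : ℕ → Bool) (n : ℕ) : ℕ → Bool :=
  Nat.rec (fun _ => false) (fun _ ih x =>
    cond (beq x 0) true
      (force (highBit x) fun q => cond (f q) (force (xor x (shiftLeft 1 q)) ih) false)) n

/-- Depth-first search through `n` levels, with `base` at the leaves. -/
noncomputable def explore (d u : ℕ) (base : ℕ → ℕ → List ℕ → List Rec → Bool) (n : ℕ) :
    ℕ → ℕ → List ℕ → List Rec → Bool :=
  Nat.rec base (fun _ ih t M us ds =>
    force (strip (land M flag) 44 (land M cand)) fun p =>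
    cond (isFree M p)
      (allBits (fun q => assign d u t M us ds p q ih) 43 (row M p)) false) n

/-- Adds the pairs of `trail` to a state. -/
noncomputable def replay (d u : ℕ) (base : ℕ → ℕ → List ℕ → List Rec → Bool)
    (trail : List (ℕ × ℕ)) : ℕ → ℕ → List ℕ → List Rec → Bool :=
  List.rec base (fun x _ ih t M us ds =>
    cond (isFree M x.1) (assign d u t M us ds x.1 x.2 ih) false) trail

/-- Every cell on `trail` has its partner there as its only candidate. -/
noncomputable def singles (M : ℕ) (trail : List (ℕ × ℕ)) : Bool :=
  List.rec true (fun x _ ih => cond (beq (row M x.1) (shiftLeft 1 x.2)) ih false) trail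

/-- Exchanges the bits of `x` marked by `m` with those `s` places higher. -/
def blockSwap (m s x : ℕ) : ℕ :=
  lor (minus x (lor m (shiftLeft m s)))
    (lor (land (shiftRight x s) m) (shiftLeft (land x m) s))

/-- Exchanges the rows `a` and `a + s` and the columns `a'` and `a' + s'` of the grid. -/
structure Swap where
  a : ℕ
  s : ℕ
  a' : ℕ
  s' : ℕ

def Swap.act (g : Swap) (M : ℕ) : ℕ :=
  blockSwap (shiftLeft outerRow (mul 301 g.a)) (mul 301 g.s)
   (blockSwap (shiftLeft innerRow (mul 7 g.a)) (mul 7 g.s)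
    (blockSwap (shiftLeft outerCol (mul 43 g.a')) (mul 43 g.s')
     (blockSwap (shiftLeft innerCol g.a') g.s' M)))

noncomputable def stabilizer (M : ℕ) (l : List Swap) : List Swap :=
  List.rec [] (fun g _ ih => cond (beq (g.act M) M) (g :: ih) ih) l

/-- The orbit step of a set of pairs under the swaps in `H`. -/
noncomputable def spread (H : List Swap) : ℕ → ℕ :=
  List.rec (fun B => B) (fun g _ ih B => force (lor B (g.act B)) ih) H

def pairBits (p q : ℕ) : ℕ :=
  lor (shiftLeft 1 (add (mul 43 (add p 1)) q)) (shiftLeft 1 (add (mul 43 (add q 1)) p))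

noncomputable def assignBits (M p q : ℕ) : ℕ :=
  cond (beq p q) (minus M (minus (cellMask p) (lor flag (pairBits p q))))
    (land (minus M (minus (lor (cellMask p) (cellMask q)) (lor flag (pairBits p q))))
      (lor (lor (outerMask p q) (innerMask p q)) (lor diag flag)))

/-- Branches on the partner of a cell; a refuted pair is deleted with its orbit under `H`. -/
noncomputable def branch (child : ℕ → ℕ → ℕ → Bool) (leaf : ℕ → Bool) (H : List Swap) (n : ℕ) :
    ℕ → Bool :=
  Nat.rec (fun _ => false) (fun _ ih M =>
    force (strip flag 1 (land M cand)) fun p => cond (beq p 42)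
      -- No row is empty here, so subtracting 1 in every row deletes its lowest candidate. The flags
      -- that remain mark the rows with at least two candidates.
      (force (strip (land flag (add (land (land M cand) (sub (land M cand) (shiftRight flag 42)))
          ones)) 44 (land M cand)) fun p =>
        cond (ble p 41)
          (force (minus (row M p) (shiftLeft 1 p)) fun x =>
            force (cond (beq x 0) p (highBit x)) fun q =>
            cond (ble q 41)
             (cond (child p q (assignBits M p q))
              -- Any number of orbit steps is sound; three need not reach the whole orbit. The
              -- residue of `M` lies below the matrix bits and serves as a tag.
              (force (spread H (spread H (spread H (lor (mod M (2 ^ 41 - 21)) (pairBits p q)))))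
                fun B => force (minus M B) ih) false) false)
          (leaf M))
      (cond (ble p 41) (beq (row M p) 0) false)) n

/-- Search through `n` levels with symmetry reduction. -/
noncomputable def shallow (leaf : ℕ → List (ℕ × ℕ) → Bool) (G : List Swap) (n : ℕ) :
    ℕ → List (ℕ × ℕ) → Bool :=
  Nat.rec leaf (fun _ ih M tr => force M fun M =>
    branch (fun p q M => ih M ((p, q) :: tr)) (fun M => leaf M tr) (stabilizer M G) 300 M) n

noncomputable def leafCheck (d u m K i M : ℕ) (tr : List (ℕ × ℕ)) : Bool :=
  cond (singles M tr)
    (replay d u (explore d u (fun t M us ds => cond (beq (mod t K) i)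
      (explore d u (fun _ _ _ _ => false) 43 t M us ds) true) m) tr 1 M [] []) false

def swaps : List Swap :=
  -- This swap exchanges the cells 0 and 41, which form the first pair tried. The other entries are
  -- the transpositions of two rows or of two columns.
  ⟨0, 5, 0, 6⟩ ::
    ((List.range 6).flatMap (fun s => (List.range (5 - s)).map (fun a => ⟨a, s + 1, 0, 0⟩)) ++
      (List.range 7).flatMap (fun s => (List.range (6 - s)).map (fun a => ⟨0, 0, a, s + 1⟩)))

noncomputable def initial : ℕ :=
  sumOver (fun p => shiftLeft (lor (shiftLeft 1 p) (minus tagField (land field (innerMask p p))))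
    (mul 43 (add p 1))) (List.range 42)

/-- Share `i` of `K` of the search for a map with `d` pairs and `u` further colours. -/
noncomputable def run (d u m K i : ℕ) : Bool :=
  shallow (leafCheck d u m K i) swaps 3 initial []

end GridSearch

/-! ### Bits of the masks -/

namespace GridSearch

theorem force_eq {α : Type} (x : ℕ) (f : ℕ → α) : force x f = f x := by
  cases x <;> rfl

theorem sumOver_eq {α : Type} (f : α → ℕ) (l : List α) : sumOver f l = (l.map f).sum := by
  induction l with
  | nil => rfl
  | cons x l ih => simpa [sumOver] using ih

/-- The bit of the pair `(x, e)` in a matrix. -/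
abbrev pos (x e : ℕ) : ℕ := 43 * (x + 1) + e

/-- The cell `x` lies on a line through `p` or `q`. -/
def near (p q x : ℕ) : Bool :=
  (x / 7 == p / 7 || x / 7 == q / 7) || (x % 7 == p % 7 || x % 7 == q % 7)

theorem testBit_eq_false_of_lt {x n j : ℕ} (hx : x < 2 ^ n) (hj : n ≤ j) : x.testBit j = false :=
  Nat.testBit_lt_two_pow (hx.trans_le (Nat.pow_le_pow_right (by norm_num) hj))

/-- A matrix has `43 * 43 = 1849` bits, so a finite table determines each constant mask. -/
theorem testBit_of_table {X : ℕ} (P : ℕ → Bool) (hX : X < 2 ^ 1849)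
    (h : ∀ j < 1849, X.testBit j = P j) (j : ℕ) : X.testBit j = (decide (j < 1849) && P j) := by
  by_cases hj : j < 1849
  · simp [hj, h j hj]
  · simp [hj, testBit_eq_false_of_lt hX (not_lt.mp hj)]

set_option maxRecDepth 100000 in
theorem testBit_colBit (j : ℕ) : colBit.testBit j = (decide (j < 1849) && (j % 43 == 0)) :=
  testBit_of_table (fun j => j % 43 == 0) (by decide +kernel) (by decide +kernel) j

set_option maxRecDepth 100000 in
theorem testBit_outerRow (j : ℕ) :
    outerRow.testBit j = (decide (j < 1849) && (decide (43 ≤ j) && decide (j < 344))) :=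
  testBit_of_table (fun j => decide (43 ≤ j) && decide (j < 344))
    (by decide +kernel) (by decide +kernel) j

set_option maxRecDepth 100000 in
theorem testBit_outerCol (j : ℕ) :
    outerCol.testBit j = (decide (j < 1849) && (decide (43 ≤ j) && ((j / 43 - 1) % 7 == 0))) :=
  testBit_of_table (fun j => decide (43 ≤ j) && ((j / 43 - 1) % 7 == 0))
    (by decide +kernel) (by decide +kernel) j

set_option maxRecDepth 100000 in
theorem testBit_innerRow (j : ℕ) :
    innerRow.testBit j = (decide (j < 1849) && decide (j % 43 < 7)) :=
  testBit_of_table (fun j => decide (j % 43 < 7)) (by decide +kernel) (by decide +kernel) j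

set_option maxRecDepth 100000 in
theorem testBit_innerCol (j : ℕ) :
    innerCol.testBit j = (decide (j < 1849) && (decide (j % 43 < 42) && (j % 43 % 7 == 0))) :=
  testBit_of_table (fun j => decide (j % 43 < 42) && (j % 43 % 7 == 0))
    (by decide +kernel) (by decide +kernel) j

set_option maxRecDepth 100000 in
theorem testBit_diag (j : ℕ) :
    diag.testBit j = (decide (j < 1849) && (decide (43 ≤ j) && (j % 43 == j / 43 - 1))) :=
  testBit_of_table (fun j => decide (43 ≤ j) && (j % 43 == j / 43 - 1))
    (by decide +kernel) (by decide +kernel) j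

set_option maxRecDepth 100000 in
theorem testBit_flag (j : ℕ) :
    flag.testBit j = (decide (j < 1849) && (decide (43 ≤ j) && (j % 43 == 42))) :=
  testBit_of_table (fun j => decide (43 ≤ j) && (j % 43 == 42))
    (by decide +kernel) (by decide +kernel) j

theorem testBit_minus (x y j : ℕ) : (minus x y).testBit j = (x.testBit j && !y.testBit j) := by
  have : minus x y = x ^^^ (x &&& y) := rfl
  rw [this, Nat.testBit_xor, Nat.testBit_and]
  cases x.testBit j <;> cases y.testBit j <;> rfl

theorem testBit_lor (x y j : ℕ) : (Nat.lor x y).testBit j = (x.testBit j || y.testBit j) :=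
  Nat.testBit_or x y j

theorem testBit_land (x y j : ℕ) : (Nat.land x y).testBit j = (x.testBit j && y.testBit j) :=
  Nat.testBit_and x y j

theorem testBit_shiftLeft (x s j : ℕ) :
    (Nat.shiftLeft x s).testBit j = (decide (s ≤ j) && x.testBit (j - s)) :=
  Nat.testBit_shiftLeft x

theorem testBit_shiftRight (x s j : ℕ) : (Nat.shiftRight x s).testBit j = x.testBit (s + j) :=
  Nat.testBit_shiftRight x

theorem testBit_outerRow_shift (a j : ℕ) :
    (Nat.shiftLeft outerRow (Nat.mul 301 a)).testBit j =
      decide (43 * (7 * a + 1) ≤ j ∧ j < 43 * (7 * a + 8)) := by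
  rw [testBit_shiftLeft, testBit_outerRow, Bool.eq_iff_iff]
  simp only [Bool.and_eq_true, decide_eq_true_eq, Nat.mul_eq]
  omega

theorem testBit_outerCol_shift {a x e : ℕ} (ha : a < 7) (hx : x < 42) (he : e < 43) :
    (Nat.shiftLeft outerCol (Nat.mul 43 a)).testBit (pos x e) = (x % 7 == a) := by
  rw [testBit_shiftLeft, testBit_outerCol, Bool.eq_iff_iff]
  simp only [Bool.and_eq_true, decide_eq_true_eq, beq_iff_eq, Nat.mul_eq, pos]
  by_cases h : a ≤ x + 1
  · obtain ⟨y, hy⟩ := Nat.exists_eq_add_of_le h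
    have : 43 * (x + 1) + e - 43 * a = 43 * y + e := by omega
    rw [this]
    omega
  · omega

theorem testBit_innerRow_shift {a x e : ℕ} (ha : a < 6) (hx : x ≤ 42) (he : e < 43) :
    (Nat.shiftLeft innerRow (Nat.mul 7 a)).testBit (43 * x + e) = (e / 7 == a && decide (e < 42)) := by
  rw [testBit_shiftLeft, testBit_innerRow, Bool.eq_iff_iff]
  simp only [Bool.and_eq_true, decide_eq_true_eq, beq_iff_eq, Nat.mul_eq]
  rcases le_or_gt (7 * a) e with h | h
  · obtain ⟨y, rfl⟩ := Nat.exists_eq_add_of_le h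
    have h1 : 43 * x + (7 * a + y) - 7 * a = 43 * x + y := by omega
    have h2 : (43 * x + y) % 43 = y := by omega
    rw [h1, h2]
    omega
  · rcases x with _ | x
    · omega
    · obtain ⟨y, hy⟩ := Nat.exists_eq_add_of_lt h
      have : 43 * (x + 1) + e - 7 * a = 43 * x + (42 - y) := by omega
      rw [this]
      omega

theorem testBit_innerCol_shift {a x e : ℕ} (ha : a < 7) (hx : x ≤ 42) (he : e < 43) :
    (Nat.shiftLeft innerCol a).testBit (43 * x + e) = (e % 7 == a && decide (e < 42)) := by
  rw [testBit_shiftLeft, testBit_innerCol, Bool.eq_iff_iff]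
  simp only [Bool.and_eq_true, decide_eq_true_eq, beq_iff_eq]
  rcases le_or_gt a e with h | h
  · obtain ⟨y, rfl⟩ := Nat.exists_eq_add_of_le h
    have h1 : 43 * x + (a + y) - a = 43 * x + y := by omega
    have h2 : (43 * x + y) % 43 = y := by omega
    rw [h1, h2]
    omega
  · rcases x with _ | x
    · omega
    · obtain ⟨y, hy⟩ := Nat.exists_eq_add_of_lt h
      -- The shift borrows from the previous row and lands on an offset from 37 to 42. The only
      -- multiple of 7 there is 42, which `innerCol` leaves out.
      have h1 : 43 * (x + 1) + e - a = 43 * x + (42 - y) := by omega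
      have h2 : (43 * x + (42 - y)) % 43 = 42 - y := by omega
      rw [h1, h2]
      omega

theorem testBit_outerMask {p q x e : ℕ} (hp : p < 42) (hq : q < 42) (hx : x < 42) (he : e < 43) :
    (outerMask p q).testBit (pos x e) = near p q x := by
  have h : outerMask p q = Nat.lor
      (Nat.lor (Nat.shiftLeft outerRow (Nat.mul 301 (p / 7)))
        (Nat.shiftLeft outerRow (Nat.mul 301 (q / 7))))
      (Nat.lor (Nat.shiftLeft outerCol (Nat.mul 43 (p % 7)))
        (Nat.shiftLeft outerCol (Nat.mul 43 (q % 7)))) := rfl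
  rw [h]
  simp only [testBit_lor]
  rw [testBit_outerRow_shift, testBit_outerRow_shift,
    testBit_outerCol_shift (by omega) hx he, testBit_outerCol_shift (by omega) hx he,
    Bool.eq_iff_iff]
  simp only [near, pos, Bool.or_eq_true, decide_eq_true_eq, beq_iff_eq]
  omega

theorem testBit_innerMask {p q x e : ℕ} (hp : p < 42) (hq : q < 42) (hx : x ≤ 42) (he : e < 42) :
    (innerMask p q).testBit (43 * x + e) = near p q e := by
  have h : innerMask p q = Nat.lor
      (Nat.lor (Nat.shiftLeft innerRow (Nat.mul 7 (p / 7)))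
        (Nat.shiftLeft innerRow (Nat.mul 7 (q / 7))))
      (Nat.lor (Nat.shiftLeft innerCol (p % 7)) (Nat.shiftLeft innerCol (q % 7))) := rfl
  rw [h]
  simp only [testBit_lor]
  rw [testBit_innerRow_shift (by omega) hx (by omega), testBit_innerRow_shift (by omega) hx (by omega),
    testBit_innerCol_shift (by omega) hx (by omega), testBit_innerCol_shift (by omega) hx (by omega)]
  simp [near, he]

theorem testBit_cellMask {p x e : ℕ} (hp : p < 42) (hx : x < 42) (he : e < 43) :
    (cellMask p).testBit (pos x e) = (x == p || e == p) := by
  have ht : ∀ j, tagField.testBit j = decide (j < 43) := by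
    intro j; exact Nat.testBit_two_pow_sub_one 43 j
  rw [Bool.eq_iff_iff]
  simp only [cellMask, testBit_lor, testBit_shiftLeft, testBit_colBit, ht, pos,
    Bool.or_eq_true, Bool.and_eq_true, decide_eq_true_eq, beq_iff_eq, Nat.mul_eq, Nat.add_eq]
  omega

theorem testBit_flag_pos {x e : ℕ} (hx : x < 42) (he : e < 43) :
    flag.testBit (pos x e) = (e == 42) := by
  rw [testBit_flag, Bool.eq_iff_iff]
  simp only [pos, Bool.and_eq_true, decide_eq_true_eq, beq_iff_eq]
  omega

theorem testBit_diag_pos {x e : ℕ} (hx : x < 42) (he : e < 43) :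
    diag.testBit (pos x e) = (e == x) := by
  rw [testBit_diag, Bool.eq_iff_iff]
  simp only [pos, Bool.and_eq_true, decide_eq_true_eq, beq_iff_eq]
  omega

theorem bitAt_eq (x i : ℕ) : bitAt x i = (x.testBit i).toNat := by
  have : bitAt x i = (x >>> i) &&& 1 := rfl
  rw [this, Nat.and_one_is_mod, Nat.shiftRight_eq_div_pow, Nat.testBit_eq_decide_div_mod_eq]
  rcases Nat.mod_two_eq_zero_or_one (x / 2 ^ i) with h | h <;> simp [h]

theorem bitAt_innerMask {p q x : ℕ} (hp : p < 42) (hq : q < 42) (hx : x < 42) :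
    bitAt (innerMask p q) x = (near p q x).toNat := by
  have := testBit_innerMask hp hq (x := 0) (by norm_num) hx
  rw [bitAt_eq, ← this]; simp

theorem isFree_iff {M p : ℕ} : isFree M p = true ↔ p < 42 ∧ M.testBit (pos p 42) = true := by
  have h : pos p 42 = 85 + 43 * p := by simp only [pos]; ring
  rw [h]
  unfold isFree
  change cond (Nat.ble p 41) (Nat.beq 1 (bitAt M (85 + 43 * p))) false = true ↔ _
  rw [bitAt_eq]
  cases h1 : Nat.ble p 41
  · have : ¬ p ≤ 41 := by intro h; simp [Nat.ble_eq_true_of_le h] at h1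
    simp; intro h; omega
  · have : p ≤ 41 := Nat.le_of_ble_eq_true h1
    cases M.testBit (85 + 43 * p) <;> simp [Nat.lt_succ_iff, this]

theorem testBit_row {M p e : ℕ} (he : e < 42) : (row M p).testBit e = M.testBit (pos p e) := by
  have hf : ∀ j, field.testBit j = decide (j < 42) := by
    intro j; exact Nat.testBit_two_pow_sub_one 42 j
  simp only [row, testBit_land, testBit_shiftRight, hf, he, decide_true, Bool.and_true, Nat.mul_eq,
    Nat.add_eq]

theorem nextTag_lt (t p q : ℕ) : nextTag t p q < 2 ^ 41 := Nat.mod_lt _ (by norm_num)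

theorem testBit_tag {t x e : ℕ} (ht : t < 2 ^ 41) : t.testBit (pos x e) = false :=
  testBit_eq_false_of_lt ht (by simp only [pos]; omega)

/-! ### Counting constraints and soundness of an assignment -/

open Finset

/-- The weight of a cell in the count of fixed cells and pairs that lie near `{x, π x}`. -/
def weight (π : ℕ → ℕ) (x y : ℕ) : ℕ :=
  if y ≠ x ∧ y ≠ π x ∧ near x (π x) y ∧ near x (π x) (π y) then (if π y = y then 2 else 1) else 0

def pairWeight (π : ℕ → ℕ) (x y : ℕ) : ℕ :=
  if y ≠ x ∧ y ≠ π x ∧ near x (π x) y ∧ near x (π x) (π y) ∧ π y ≠ y then 1 else 0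

def farWeight (π : ℕ → ℕ) (x y : ℕ) : ℕ := if π y = y ∧ near x (π x) y = false then 1 else 0

/-- The counting constraints on the pairing `π` of the 42 cells that comes from `d` colours with two
cells each, when there are `u` further colours. -/
structure Sol (d u : ℕ) (π : ℕ → ℕ) : Prop where
  lt : ∀ x < 42, π x < 42
  inv : ∀ x < 42, π (π x) = x
  apart : ∀ x < 42, π x ≠ x → π x / 7 ≠ x / 7 ∧ π x % 7 ≠ x % 7
  meet : ∀ x < 42, ∀ y < 42, π x ≠ x → π y ≠ y → near x (π x) y ∨ near x (π x) (π y)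
  total : ∑ y ∈ range 42, (if π y = y then 1 else 0) ≤ 42 - 2 * d
  row : ∀ i, ∑ y ∈ range 42, (if π y = y ∧ y / 7 = i then 1 else 0) ≤ u
  col : ∀ i, ∑ y ∈ range 42, (if π y = y ∧ y % 7 = i then 1 else 0) ≤ u
  weight_le : ∀ x < 42, π x ≠ x → ∑ y ∈ range 42, weight π x y ≤ 2 * (21 - d)
  pairWeight_le : ∀ x < 42, π x ≠ x → ∑ y ∈ range 42, pairWeight π x y ≤ 2 * (21 - d - u)
  farWeight_le : ∀ x < 42, π x ≠ x → ∑ y ∈ range 42, farWeight π x y ≤ 42 - 2 * d - u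

/-- The matrix `M` admits `π` outside the set `T` of settled cells. -/
structure Admits (π : ℕ → ℕ) (T : Finset ℕ) (M : ℕ) : Prop where
  bit : ∀ x < 42, x ∉ T → M.testBit (pos x (π x)) = true
  free : ∀ x < 42, M.testBit (pos x 42) = true → x ∉ T

/-- The counters are only lower bounds for what the settled cells contribute. The factor 2 arises
because `weight` and `pairWeight` count each of the two cells of a pair, while a fixed cell has
weight 2. -/
structure RecValid (π : ℕ → ℕ) (T : Finset ℕ) (r : Rec) : Prop where
  p_lt : r.p < 42
  eq : π r.p = r.q
  ne : r.q ≠ r.p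
  p_mem : r.p ∈ T
  q_mem : r.q ∈ T
  np_eq : r.np = outerMask r.p r.q
  nq_eq : r.nq = innerMask r.p r.q
  a_le : 2 * r.a ≤ ∑ y ∈ T, weight π r.p y
  b_le : 2 * r.b ≤ ∑ y ∈ T, pairWeight π r.p y
  c_le : r.c ≤ ∑ y ∈ T, farWeight π r.p y

/-- Quantifying `sum_le` over all weights says that the recorded cells are distinct members of `T`,
in the form in which every counter uses it. -/
structure Valid (π : ℕ → ℕ) (T : Finset ℕ) (M : ℕ) (us : List ℕ) (ds : List Rec) : Prop where
  admits : Admits π T M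
  lt : ∀ x ∈ T, x < 42
  closed : ∀ x < 42, x ∉ T → π x ∉ T
  fixed : ∀ x ∈ us, x ∈ T ∧ π x = x
  sum_le : ∀ w : ℕ → ℕ, (us.map w).sum + (ds.map fun r => w r.p + w r.q).sum ≤ ∑ y ∈ T, w y
  recs : ∀ r ∈ ds, RecValid π T r

variable {d u : ℕ} {π : ℕ → ℕ}

theorem sum_add_le {T : Finset ℕ} (hT : ∀ x ∈ T, x < 42) {x : ℕ} (hx : x < 42) (hxT : x ∉ T)
    (w : ℕ → ℕ) : ∑ y ∈ T, w y + w x ≤ ∑ y ∈ range 42, w y := by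
  rw [add_comm, ← sum_insert hxT]
  exact sum_le_sum_of_subset (by
    intro y hy
    rcases mem_insert.mp hy with rfl | h
    · simpa using hx
    · simpa using hT y h)

theorem sum_le_range {T : Finset ℕ} (hT : ∀ x ∈ T, x < 42)
    (w : ℕ → ℕ) : ∑ y ∈ T, w y ≤ ∑ y ∈ range 42, w y :=
  sum_le_sum_of_subset (fun y hy => by simpa using hT y hy)

theorem near_self (p q : ℕ) : near p q p = true := by simp [near]

theorem near_right (p q : ℕ) : near p q q = true := by simp [near]

theorem Admits.mono {T : Finset ℕ} {M M' : ℕ} (h : Admits π T M)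
    (hle : ∀ x < 42, M'.testBit (pos x 42) = true → M.testBit (pos x 42) = true)
    (hbit : ∀ x < 42, x ∉ T → M.testBit (pos x (π x)) = true → M'.testBit (pos x (π x)) = true) :
    Admits π T M' :=
  ⟨fun x hx hxT => hbit x hx hxT (h.bit x hx hxT), fun x hx hf => h.free x hx (hle x hx hf)⟩

theorem RecValid.q_lt (hS : Sol d u π) {T : Finset ℕ} {r : Rec} (h : RecValid π T r) : r.q < 42 :=
  h.eq ▸ hS.lt _ h.p_lt

theorem beq_iff {a b : ℕ} : Nat.beq a b = true ↔ a = b := by rw [Nat.beq_eq]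

/-- When a counter has reached its bound, the settled cells exhaust the corresponding sum in `Sol`.
An unsettled cell of positive weight would exceed it, so `π` uses none of the deleted entries. -/
theorem admits_filterA (hS : Sol d u π) {T : Finset ℕ} (hT : ∀ x ∈ T, x < 42) {M : ℕ}
    (h : Admits π T M) {r : Rec} (hr : RecValid π T r) :
    Admits π T (filterA d u r.np r.nq r.a r.b M) := by
  have hq := hr.q_lt hS
  have key : ∀ x < 42, x ∉ T → (Nat.land r.np r.nq).testBit (pos x (π x)) = true →
      x ≠ r.p ∧ x ≠ π r.p ∧ near r.p (π r.p) x ∧ near r.p (π r.p) (π x) := by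
    intro x hx hxT hb
    rw [testBit_land, hr.np_eq, hr.nq_eq, testBit_outerMask hr.p_lt hq hx (by have := hS.lt x hx; omega),
      testBit_innerMask hr.p_lt hq (by omega) (hS.lt x hx), ← hr.eq, Bool.and_eq_true] at hb
    refine ⟨?_, ?_, hb⟩
    · rintro rfl; exact hxT hr.p_mem
    · rintro rfl; exact hxT (hr.eq ▸ hr.q_mem)
  have hpne : π r.p ≠ r.p := hr.eq ▸ hr.ne
  unfold filterA
  cases hA : Nat.beq r.a (Nat.sub 21 d)
  · cases hB : Nat.beq r.b (Nat.sub (Nat.sub 21 d) u)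
    · exact h
    · refine h.mono (fun x hx hb => ?_) (fun x hx hxT hb => ?_)
      · rw [cond_false, cond_true, testBit_minus, Bool.and_eq_true] at hb
        exact hb.1
      · rw [cond_false, cond_true, testBit_minus, hb, Bool.true_and, Bool.not_eq_true', testBit_minus]
        by_contra hc
        rw [Bool.not_eq_false, Bool.and_eq_true, testBit_diag_pos hx (by have := hS.lt x hx; omega)] at hc
        obtain ⟨h1, h2, h3, h4⟩ := key x hx hxT hc.1
        have h5 : π x ≠ x := by simpa using hc.2
        have := sum_add_le hT hx hxT (pairWeight π r.p)
        have h6 : pairWeight π r.p x = 1 := by simp [pairWeight, *]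
        have h7 := hS.pairWeight_le r.p hr.p_lt hpne
        have h8 := hr.b_le
        have h9 : r.b = 21 - d - u := beq_iff.mp hB
        omega
  · refine h.mono (fun x hx hb => ?_) (fun x hx hxT hb => ?_)
    · rw [cond_true, testBit_minus, Bool.and_eq_true] at hb
      exact hb.1
    · rw [cond_true, testBit_minus, hb, Bool.true_and, Bool.not_eq_true']
      by_contra hc
      rw [Bool.not_eq_false] at hc
      obtain ⟨h1, h2, h3, h4⟩ := key x hx hxT hc
      have := sum_add_le hT hx hxT (weight π r.p)
      have h6 : 1 ≤ weight π r.p x := by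
        simp only [weight, h1, h2, h3, h4, ne_eq, not_false_eq_true, and_self, if_true]
        split <;> omega
      have h7 := hS.weight_le r.p hr.p_lt hpne
      have h8 := hr.a_le
      have h9 : r.a = 21 - d := beq_iff.mp hA
      omega

theorem admits_filterC (hS : Sol d u π) {T : Finset ℕ} (hT : ∀ x ∈ T, x < 42) {M : ℕ}
    (h : Admits π T M) {r : Rec} (hr : RecValid π T r) :
    Admits π T (filterC d u r.np r.c M) := by
  have hq := hr.q_lt hS
  have hpne : π r.p ≠ r.p := hr.eq ▸ hr.ne
  unfold filterC
  cases hC : Nat.beq r.c (Nat.sub (Nat.sub 42 (Nat.mul 2 d)) u)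
  · exact h
  · refine h.mono (fun x hx hb => ?_) (fun x hx hxT hb => ?_)
    · rw [cond_true, testBit_lor, testBit_minus, testBit_land] at hb
      cases hM : M.testBit (pos x 42)
      · simp [hM] at hb
      · rfl
    · have hlt := hS.lt x hx
      rw [cond_true, testBit_lor, testBit_minus, testBit_land, hb, Bool.true_and, Bool.true_and,
        testBit_diag_pos hx (by omega), hr.np_eq, testBit_outerMask hr.p_lt hq hx (by omega)]
      by_contra hc
      rw [Bool.not_eq_true, Bool.or_eq_false_iff] at hc
      have h1 : π x = x := by simpa using hc.1
      have h6 : farWeight π r.p x = 1 := by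
        rw [← hr.eq] at hc; simp [farWeight, h1, hc.2]
      have := sum_add_le hT hx hxT (farWeight π r.p)
      have h7 := hS.farWeight_le r.p hr.p_lt hpne
      have h8 := hr.c_le
      have h9 : r.c = 42 - 2 * d - u := beq_iff.mp hC
      omega

theorem RecValid.mono {T T' : Finset ℕ} {r : Rec} (h : RecValid π T r) (hT : T ⊆ T') :
    RecValid π T' r :=
  { h with
    p_mem := hT h.p_mem
    q_mem := hT h.q_mem
    a_le := h.a_le.trans (sum_le_sum_of_subset hT)
    b_le := h.b_le.trans (sum_le_sum_of_subset hT)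
    c_le := h.c_le.trans (sum_le_sum_of_subset hT) }

/-- The continuations form a family over `ι` because the shares of a split search pass through the
same states: one valid state must serve all of them. Keeping the list of pairs `(p, q)` lets
`Valid.sum_le` carry over. -/
theorem passFixed_sound (hS : Sol d u π) {ι : Type} {T : Finset ℕ}
    {x : ℕ} (hx : x < 42) (hxT : x ∉ T) (hfix : π x = x) (hT : ∀ y ∈ insert x T, y < 42)
    (l : List Rec) : ∀ (M : ℕ) (k : ι → ℕ → List Rec → Bool),
    (∀ i, passFixed d u x l M (k i) = true) → Admits π (insert x T) M → (∀ r ∈ l, RecValid π T r) →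
    ∃ M' l', Admits π (insert x T) M' ∧ (∀ r ∈ l', RecValid π (insert x T) r) ∧
      l'.map (fun r => (r.p, r.q)) = l.map (fun r => (r.p, r.q)) ∧ ∀ i, k i M' l' = true := by
  induction l with
  | nil => exact fun M k hk hM _ => ⟨M, [], hM, by simp, rfl, hk⟩
  | cons r l ih =>
    intro M k hk hM hl
    have hr := hl r (by simp)
    have hq := hr.q_lt hS
    have hr' := hr.mono (subset_insert x T)
    have hxp : x ≠ r.p := by rintro rfl; exact hxT hr.p_mem
    have hxq : x ≠ π r.p := by rintro rfl; exact hxT (hr.eq ▸ hr.q_mem)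
    have hstep : ∀ i, cond (Nat.beq (bitAt r.nq x) 0)
      (force (Nat.add r.c 1) fun c => force (filterC d u r.np c M) fun M =>
        passFixed d u x l M fun M rs => k i M (⟨r.p, r.q, r.np, r.nq, r.a, r.b, c⟩ :: rs))
      (force (Nat.add r.a 1) fun a => force (filterA d u r.np r.nq a r.b M) fun M =>
        passFixed d u x l M fun M rs => k i M (⟨r.p, r.q, r.np, r.nq, a, r.b, r.c⟩ :: rs)) = true := hk
    simp only [force_eq] at hstep
    have hbit : bitAt r.nq x = (near r.p (π r.p) x).toNat := by
      rw [hr.nq_eq, bitAt_innerMask hr.p_lt hq hx, hr.eq]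
    have main : ∀ r₁ : Rec, RecValid π (insert x T) r₁ → r₁.p = r.p → r₁.q = r.q → ∀ M₁,
        Admits π (insert x T) M₁ →
        (∀ i, passFixed d u x l M₁ (fun M rs => k i M (r₁ :: rs)) = true) →
        ∃ M' l', Admits π (insert x T) M' ∧ (∀ r ∈ l', RecValid π (insert x T) r) ∧
          l'.map (fun r => (r.p, r.q)) = (r :: l).map (fun r => (r.p, r.q)) ∧
          ∀ i, k i M' l' = true := by
      intro r₁ hv h1 h2 M₁ hM₁ hk₁
      obtain ⟨M', l', g1, g2, g3, g4⟩ := ih M₁ (fun i M rs => k i M (r₁ :: rs)) hk₁ hM₁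
        (fun r hr => hl r (by simp [hr]))
      refine ⟨M', r₁ :: l', g1, ?_, by simp [h1, h2, g3], g4⟩
      intro r hr
      rcases List.mem_cons.mp hr with rfl | hr
      · exact hv
      · exact g2 r hr
    cases hn : near r.p (π r.p) x
    · rw [hn] at hbit
      simp only [hbit, Bool.toNat_false] at hstep
      have hv : RecValid π (insert x T) ⟨r.p, r.q, r.np, r.nq, r.a, r.b, Nat.add r.c 1⟩ :=
        { hr' with
          c_le := by
            have h1 : farWeight π r.p x = 1 := by simp [farWeight, hfix, hn]
            have := hr.c_le
            change r.c + 1 ≤ _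
            rw [sum_insert hxT]
            change r.c + 1 ≤ farWeight π r.p x + ∑ y ∈ T, farWeight π r.p y
            omega }
      exact main _ hv rfl rfl _ (admits_filterC hS hT hM hv) hstep
    · rw [hn] at hbit
      simp only [hbit, Bool.toNat_true] at hstep
      have hv : RecValid π (insert x T) ⟨r.p, r.q, r.np, r.nq, Nat.add r.a 1, r.b, r.c⟩ :=
        { hr' with
          a_le := by
            have h1 : weight π r.p x = 2 := by simp [weight, hfix, hn, hxp, hxq]
            have := hr.a_le
            change 2 * (r.a + 1) ≤ _
            rw [sum_insert hxT]
            change 2 * (r.a + 1) ≤ weight π r.p x + ∑ y ∈ T, weight π r.p y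
            omega }
      exact main _ hv rfl rfl _ (admits_filterA hS hT hM hv) hstep

theorem passPair_sound (hS : Sol d u π) {ι : Type} {T : Finset ℕ}
    {x : ℕ} (hx : x < 42) (hxT : x ∉ T) (hne : π x ≠ x) (hxT' : π x ∉ T)
    (hT : ∀ y ∈ insert x (insert (π x) T), y < 42)
    (l : List Rec) : ∀ (M : ℕ) (k : ι → ℕ → List Rec → Bool),
    (∀ i, passPair d u x (π x) l M (k i) = true) → Admits π (insert x (insert (π x) T)) M →
    (∀ r ∈ l, RecValid π T r) →
    ∃ M' l', Admits π (insert x (insert (π x) T)) M' ∧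
      (∀ r ∈ l', RecValid π (insert x (insert (π x) T)) r) ∧
      l'.map (fun r => (r.p, r.q)) = l.map (fun r => (r.p, r.q)) ∧ ∀ i, k i M' l' = true := by
  set T' := insert x (insert (π x) T) with hT'
  have hsub : T ⊆ T' := (subset_insert _ _).trans (subset_insert _ _)
  have hsum : ∀ w : ℕ → ℕ, ∑ y ∈ T', w y = w x + (w (π x) + ∑ y ∈ T, w y) := by
    intro w
    rw [hT', sum_insert, sum_insert hxT']
    simp [hxT, Ne.symm hne]
  induction l with
  | nil => exact fun M k hk hM _ => ⟨M, [], hM, by simp, rfl, hk⟩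
  | cons r l ih =>
    intro M k hk hM hl
    have hr := hl r (by simp)
    have hq := hr.q_lt hS
    have hr' := hr.mono hsub
    have hxp : x ≠ r.p := by rintro rfl; exact hxT hr.p_mem
    have hxq : x ≠ π r.p := by rintro rfl; exact hxT (hr.eq ▸ hr.q_mem)
    have hyp : π x ≠ r.p := by intro h; exact hxT' (h ▸ hr.p_mem)
    have hyq : π x ≠ π r.p := by
      intro h; apply hxp; rw [← hS.inv x hx, h, hS.inv _ hr.p_lt]
    have hstep : ∀ i, cond (Nat.beq (Nat.land (bitAt r.nq x) (bitAt r.nq (π x))) 0)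
      (passPair d u x (π x) l M fun M rs => k i M (r :: rs))
      (force (Nat.add r.a 1) fun a => force (Nat.add r.b 1) fun b =>
        force (filterA d u r.np r.nq a b M) fun M =>
        passPair d u x (π x) l M fun M rs => k i M (⟨r.p, r.q, r.np, r.nq, a, b, r.c⟩ :: rs)) = true := hk
    simp only [force_eq] at hstep
    have hbit : Nat.land (bitAt r.nq x) (bitAt r.nq (π x)) =
        (near r.p (π r.p) x && near r.p (π r.p) (π x)).toNat := by
      rw [hr.nq_eq, bitAt_innerMask hr.p_lt hq hx, bitAt_innerMask hr.p_lt hq (hS.lt x hx), hr.eq]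
      cases near r.p r.q x <;> cases near r.p r.q (π x) <;> rfl
    have main : ∀ r₁ : Rec, RecValid π T' r₁ → r₁.p = r.p → r₁.q = r.q → ∀ M₁,
        Admits π T' M₁ →
        (∀ i, passPair d u x (π x) l M₁ (fun M rs => k i M (r₁ :: rs)) = true) →
        ∃ M' l', Admits π T' M' ∧ (∀ r ∈ l', RecValid π T' r) ∧
          l'.map (fun r => (r.p, r.q)) = (r :: l).map (fun r => (r.p, r.q)) ∧
          ∀ i, k i M' l' = true := by
      intro r₁ hv h1 h2 M₁ hM₁ hk₁
      obtain ⟨M', l', g1, g2, g3, g4⟩ := ih M₁ (fun i M rs => k i M (r₁ :: rs)) hk₁ hM₁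
        (fun r hr => hl r (by simp [hr]))
      refine ⟨M', r₁ :: l', g1, ?_, by simp [h1, h2, g3], g4⟩
      intro r hr
      rcases List.mem_cons.mp hr with rfl | hr
      · exact hv
      · exact g2 r hr
    cases hn : (near r.p (π r.p) x && near r.p (π r.p) (π x))
    · rw [hn] at hbit
      simp only [hbit, Bool.toNat_false] at hstep
      exact main r hr' rfl rfl M hM hstep
    · rw [hn] at hbit
      simp only [hbit, Bool.toNat_true] at hstep
      rw [Bool.and_eq_true] at hn
      have hinv := hS.inv x hx
      have hv : RecValid π T' ⟨r.p, r.q, r.np, r.nq, Nat.add r.a 1, Nat.add r.b 1, r.c⟩ :=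
        { hr' with
          a_le := by
            have h1 : weight π r.p x = 1 := by simp [weight, hne, hn.1, hn.2, hxp, hxq]
            have h2 : weight π r.p (π x) = 1 := by
              simp [weight, hinv, hne.symm, hn.1, hn.2, hyp, hyq]
            have := hr.a_le
            change 2 * (r.a + 1) ≤ ∑ y ∈ T', weight π r.p y
            rw [hsum]
            omega
          b_le := by
            have h1 : pairWeight π r.p x = 1 := by simp [pairWeight, hne, hn.1, hn.2, hxp, hxq]
            have h2 : pairWeight π r.p (π x) = 1 := by
              simp [pairWeight, hinv, hne.symm, hn.1, hn.2, hyp, hyq]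
            have := hr.b_le
            change 2 * (r.b + 1) ≤ ∑ y ∈ T', pairWeight π r.p y
            rw [hsum]
            omega }
      exact main _ hv rfl rfl _ (admits_filterA hS hT hM hv) hstep

theorem list_sum_mono {α : Type} {f g : α → ℕ} {l : List α} (h : ∀ x ∈ l, f x ≤ g x) :
    (l.map f).sum ≤ (l.map g).sum :=
  List.sum_le_sum h

theorem fresh_sound (hS : Sol d u π) {ι : Type} {T : Finset ℕ} {M : ℕ} {us : List ℕ}
    {ds : List Rec} (hV : Valid π T M us ds) {p : ℕ} (hp : p < 42) (hpT : p ∉ T) (hne : π p ≠ p)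
    {k : ι → Rec → Bool} (hk : ∀ i, fresh us ds p (π p) (k i) = true) :
    ∃ a b c, 2 * a ≤ ∑ y ∈ T, weight π p y ∧ 2 * b ≤ ∑ y ∈ T, pairWeight π p y ∧
      c ≤ ∑ y ∈ T, farWeight π p y ∧
      ∀ i, k i ⟨p, π p, outerMask p (π p), innerMask p (π p), a, b, c⟩ = true := by
  have hq := hS.lt p hp
  have hqT := hV.closed p hp hpT
  simp only [fresh, force_eq, sumOver_eq] at hk
  refine ⟨_, _, _, ?_, ?_, ?_, hk⟩
  · refine le_trans ?_ (hV.sum_le (weight π p))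
    change 2 * (_ + _) ≤ _
    rw [mul_add, add_comm, ← List.sum_map_mul_left, ← List.sum_map_mul_left]
    refine add_le_add (list_sum_mono fun x hx => ?_) (list_sum_mono fun r hr => ?_)
    · obtain ⟨hxT, hfix⟩ := hV.fixed x hx
      have h1 : x ≠ p := by rintro rfl; exact hpT hxT
      have h2 : x ≠ π p := by rintro rfl; exact hqT hxT
      rw [bitAt_innerMask hp hq (hV.lt x hxT)]
      cases hn : near p (π p) x <;> simp [weight, hfix, hn, h1, h2]
    · have hr := hV.recs r hr
      have h1 : r.p ≠ p := by intro h; exact hpT (h ▸ hr.p_mem)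
      have h2 : r.p ≠ π p := by intro h; exact hqT (h ▸ hr.p_mem)
      have h3 : r.q ≠ p := by intro h; exact hpT (h ▸ hr.q_mem)
      have h4 : r.q ≠ π p := by intro h; exact hqT (h ▸ hr.q_mem)
      have h5 : π r.q = r.p := by rw [← hr.eq, hS.inv _ hr.p_lt]
      have h6 := hr.ne
      rw [bitAt_innerMask hp hq hr.p_lt, bitAt_innerMask hp hq (hr.q_lt hS)]
      cases hn : near p (π p) r.p <;> cases hm : near p (π p) r.q <;>
        simp [weight, hr.eq, h5, hn, hm, h1, h2, h3, h4, h6, h6.symm]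
  · refine le_trans ?_ (hV.sum_le (pairWeight π p))
    refine le_trans ?_ (Nat.le_add_left _ _)
    rw [← List.sum_map_mul_left]
    refine list_sum_mono fun r hr => ?_
    have hr := hV.recs r hr
    have h1 : r.p ≠ p := by intro h; exact hpT (h ▸ hr.p_mem)
    have h2 : r.p ≠ π p := by intro h; exact hqT (h ▸ hr.p_mem)
    have h3 : r.q ≠ p := by intro h; exact hpT (h ▸ hr.q_mem)
    have h4 : r.q ≠ π p := by intro h; exact hqT (h ▸ hr.q_mem)
    have h5 : π r.q = r.p := by rw [← hr.eq, hS.inv _ hr.p_lt]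
    have h6 := hr.ne
    rw [bitAt_innerMask hp hq hr.p_lt, bitAt_innerMask hp hq (hr.q_lt hS)]
    cases hn : near p (π p) r.p <;> cases hm : near p (π p) r.q <;>
      simp [pairWeight, hr.eq, h5, hn, hm, h1, h2, h3, h4, h6, h6.symm]
  · refine le_trans ?_ (hV.sum_le (farWeight π p))
    refine le_trans ?_ (Nat.le_add_right _ _)
    refine list_sum_mono fun x hx => ?_
    obtain ⟨hxT, hfix⟩ := hV.fixed x hx
    rw [bitAt_innerMask hp hq (hV.lt x hxT)]
    cases hn : near p (π p) x <;> simp [farWeight, hfix, hn]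

/-- A line already holding `u` settled fixed cells admits no further one, by `Sol.row` and
`Sol.col`. -/
theorem lineFilter_sound (hS : Sol d u π) {T : Finset ℕ} (hT : ∀ x ∈ T, x < 42)
    {M p : ℕ} {us : List ℕ} (hp : p < 42) (hfix : ∀ x ∈ us, π x = x)
    (hsum : ∀ w : ℕ → ℕ, (us.map w).sum ≤ ∑ y ∈ T, w y) (hM : Admits π T M) :
    Admits π T (lineFilter u p us M) := by
  have main : ∀ (P : ℕ → Prop) [DecidablePred P] (B M' : ℕ),
      (∑ y ∈ range 42, (if π y = y ∧ P y then 1 else 0) ≤ u) →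
      ((us.map fun x => if P x then 1 else 0).sum = u) →
      (∀ x < 42, ¬ P x → B.testBit (pos x x) = false) →
      Admits π T M' → Admits π T (minus M' (Nat.land diag B)) := by
    intro P _ B M' h1 h2 h3 hM'
    refine hM'.mono (fun x hx hb => ?_) (fun x hx hxT hb => ?_)
    · rw [testBit_minus, Bool.and_eq_true] at hb
      exact hb.1
    · have hlt := hS.lt x hx
      rw [testBit_minus, hb, Bool.true_and, testBit_land, testBit_diag_pos hx (by omega)]
      by_cases hfx : π x = x
      · by_cases hPx : P x
        · exfalso
          have h4 := sum_add_le hT hx hxT (fun y => if π y = y ∧ P y then 1 else 0)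
          have h5 := hsum (fun y => if π y = y ∧ P y then 1 else 0)
          have h6 : (us.map fun y => if π y = y ∧ P y then 1 else 0) =
              us.map fun x => if P x then 1 else 0 := by
            apply List.map_congr_left
            intro y hy
            simp [hfix y hy]
          rw [h6, h2] at h5
          simp only [hfx, hPx, and_self, if_true] at h4
          omega
        · rw [hfx, h3 x hx hPx]; simp
      · simp [hfx]
  have hcond : ∀ (P : ℕ → Prop) [DecidablePred P] (f : ℕ → Bool) (B M' : ℕ),
      (∀ x, f x = true ↔ P x) →
      (∑ y ∈ range 42, (if π y = y ∧ P y then 1 else 0) ≤ u) →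
      (∀ x < 42, ¬ P x → B.testBit (pos x x) = false) →
      Admits π T M' →
      Admits π T (cond (Nat.beq (sumOver (fun x => cond (f x) 1 0) us) u)
        (minus M' (Nat.land diag B)) M') := by
    intro P _ f B M' hf h1 h3 hM'
    cases hb : Nat.beq (sumOver (fun x => cond (f x) 1 0) us) u
    · exact hM'
    · refine main P B M' h1 ?_ h3 hM'
      rw [← beq_iff.mp hb, sumOver_eq]
      congr 1
      apply List.map_congr_left
      intro x _
      by_cases hP : P x
      · simp [hP, (hf x).mpr hP]
      · have : f x = false := by rw [← Bool.not_eq_true, hf]; exact hP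
        simp [hP, this]
  unfold lineFilter
  refine hcond (fun x => x % 7 = p % 7) _ _ _ (fun x => beq_iff) (hS.col _) ?_ ?_
  · intro x hx hP
    have h := testBit_outerCol_shift (a := p % 7) (x := x) (e := x) (by omega) hx (by omega)
    change (Nat.shiftLeft outerCol (Nat.mul 43 (p % 7))).testBit _ = _
    rw [h]; simpa using hP
  · refine hcond (fun x => x / 7 = p / 7) _ _ _ (fun x => beq_iff) (hS.row _) ?_ hM
    intro x hx hP
    change (Nat.shiftLeft outerRow (Nat.mul 301 (p / 7))).testBit _ = _
    rw [testBit_outerRow_shift, decide_eq_false_iff_not]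
    simp only [pos]
    omega

/-- Following the true partner `π p` keeps the state valid: the bound tests cannot fail, since they
follow from `Sol`, and each deletion spares the entries of `π` outside the settled cells. -/
theorem assign_sound (hS : Sol d u π) {ι : Type} {T : Finset ℕ} {t M : ℕ} {us : List ℕ}
    {ds : List Rec} (hV : Valid π T M us ds) {p : ℕ} (hp : p < 42) (hpT : p ∉ T)
    {k : ι → ℕ → ℕ → List ℕ → List Rec → Bool}
    (hk : ∀ i, assign d u t M us ds p (π p) (k i) = true) :
    ∃ T' t' M' us' ds', Valid π T' M' us' ds' ∧ ∀ i, k i t' M' us' ds' = true := by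
  have hq := hS.lt p hp
  have hqT := hV.closed p hp hpT
  have ht : ∀ x e, (nextTag t p (π p)).testBit (pos x e) = false :=
    fun x e => testBit_tag (nextTag_lt t p (π p))
  simp only [assign, force_eq] at hk
  by_cases hfix : π p = p
  · rw [hfix, Nat.beq_refl] at hk
    simp only [cond_true] at hk
    have hT : ∀ y ∈ insert p T, y < 42 := by
      intro y hy
      rcases mem_insert.mp hy with rfl | h
      · exact hp
      · exact hV.lt y h
    have hsum : ∀ w : ℕ → ℕ, ((p :: us).map w).sum + (ds.map fun r => w r.p + w r.q).sum ≤
        ∑ y ∈ insert p T, w y := by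
      intro w
      rw [sum_insert hpT, List.map_cons, List.sum_cons, add_assoc]
      exact Nat.add_le_add_left (hV.sum_le w) _
    have hus : ∀ x ∈ p :: us, π x = x := by
      intro x hx
      rcases List.mem_cons.mp hx with rfl | h
      · exact hfix
      · exact (hV.fixed x h).2
    have h0 : Admits π (insert p T) (Nat.lor (minus M (cellMask p)) (nextTag t p p)) := by
      rw [hfix] at ht
      refine ⟨fun x hx hxT => ?_, fun x hx hb => ?_⟩
      · have hlt := hS.lt x hx
        rw [mem_insert, not_or] at hxT
        have hne : π x ≠ p := by
          intro h; apply hxT.1; rw [← hS.inv x hx, h, hfix]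
        rw [testBit_lor, testBit_minus, hV.admits.bit x hx hxT.2, testBit_cellMask hp hx (by omega)]
        simp [hxT.1, hne]
      · rw [testBit_lor, ht, Bool.or_false, testBit_minus, Bool.and_eq_true,
          testBit_cellMask hp hx (by omega)] at hb
        rw [mem_insert, not_or]
        exact ⟨by rintro rfl; simp at hb, hV.admits.free x hx hb.1⟩
    have h1 : Admits π (insert p T)
        (cond (Nat.beq (p :: us).length (Nat.sub 42 (Nat.mul 2 d)))
          (minus (Nat.lor (minus M (cellMask p)) (nextTag t p p)) diag)
          (Nat.lor (minus M (cellMask p)) (nextTag t p p))) := by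
      cases hb : Nat.beq (p :: us).length (Nat.sub 42 (Nat.mul 2 d))
      · exact h0
      · refine h0.mono (fun x hx hb => ?_) (fun x hx hxT hb' => ?_)
        · rw [cond_true, testBit_minus, Bool.and_eq_true] at hb
          exact hb.1
        · have hlt := hS.lt x hx
          rw [cond_true, testBit_minus, hb', Bool.true_and, testBit_diag_pos hx (by omega)]
          have hne : π x ≠ x := by
            intro hfx
            have h2 := sum_add_le hT hx hxT (fun y => if π y = y then 1 else 0)
            have h3 := (Nat.le_add_right _ _).trans (hsum (fun y => if π y = y then 1 else 0))
            have h4 : ((p :: us).map fun y => if π y = y then 1 else 0) =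
                (p :: us).map fun _ => 1 := by
              apply List.map_congr_left
              intro y hy
              simp [hus y hy]
            rw [h4, List.map_const', List.sum_replicate, smul_eq_mul, mul_one] at h3
            have h5 := hS.total
            have h6 : (p :: us).length = 42 - 2 * d := beq_iff.mp hb
            simp only [hfx, if_true] at h2
            omega
          simp [hne]
    have h2 := lineFilter_sound hS hT hp hus
      (fun w => (Nat.le_add_right _ _).trans (hsum w)) h1
    obtain ⟨M', l', g1, g2, g3, g4⟩ := passFixed_sound hS hp hpT hfix hT ds _ _ hk h2 hV.recs
    refine ⟨insert p T, _, M', p :: us, l', ⟨g1, hT, ?_, ?_, ?_, g2⟩, g4⟩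
    · intro x hx hxT
      rw [mem_insert, not_or] at hxT ⊢
      refine ⟨?_, hV.closed x hx hxT.2⟩
      intro h; apply hxT.1; rw [← hS.inv x hx, h, hfix]
    · intro x hx
      refine ⟨?_, hus x hx⟩
      rcases List.mem_cons.mp hx with rfl | h
      · exact mem_insert_self _ _
      · exact mem_insert_of_mem (hV.fixed x h).1
    · intro w
      have h3 : l'.map (fun r => w r.p + w r.q) = ds.map fun r => w r.p + w r.q := by
        have := congrArg (List.map fun z : ℕ × ℕ => w z.1 + w z.2) g3
        simpa [Function.comp_def] using this
      rw [h3]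
      exact hsum w
  · have hb : Nat.beq p (π p) = false := by
      rw [← Bool.not_eq_true, beq_iff]; exact fun h => hfix h.symm
    rw [hb] at hk
    simp only [cond_false] at hk
    obtain ⟨a, b, c, ha, hb', hc, hk⟩ := fresh_sound hS hV hp hpT hfix hk
    have ha' : Nat.ble a (Nat.sub 21 d) = true := by
      apply Nat.ble_eq_true_of_le
      have h1 := hS.weight_le p hp hfix
      have h2 := sum_le_range hV.lt (weight π p)
      change a ≤ 21 - d
      omega
    have hb'' : Nat.ble b (Nat.sub (Nat.sub 21 d) u) = true := by
      apply Nat.ble_eq_true_of_le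
      have h1 := hS.pairWeight_le p hp hfix
      have h2 := sum_le_range hV.lt (pairWeight π p)
      change b ≤ 21 - d - u
      omega
    have hc' : Nat.ble c (Nat.sub (Nat.sub 42 (Nat.mul 2 d)) u) = true := by
      apply Nat.ble_eq_true_of_le
      have h1 := hS.farWeight_le p hp hfix
      have h2 := sum_le_range hV.lt (farWeight π p)
      change c ≤ 42 - 2 * d - u
      omega
    simp only [ha', hb'', hc', cond_true] at hk
    have hT : ∀ y ∈ insert p (insert (π p) T), y < 42 := by
      intro y hy
      rcases mem_insert.mp hy with rfl | h
      · exact hp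
      rcases mem_insert.mp h with rfl | h
      · exact hq
      · exact hV.lt y h
    have hpq : p ∉ insert (π p) T := by
      rw [mem_insert, not_or]; exact ⟨fun h => hfix h.symm, hpT⟩
    have hsub : T ⊆ insert p (insert (π p) T) := (subset_insert _ _).trans (subset_insert _ _)
    set r : Rec := ⟨p, π p, outerMask p (π p), innerMask p (π p), a, b, c⟩ with hr
    have hrv : RecValid π (insert p (insert (π p) T)) r :=
      { p_lt := hp
        eq := rfl
        ne := hfix
        p_mem := mem_insert_self _ _
        q_mem := mem_insert_of_mem (mem_insert_self _ _)
        np_eq := rfl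
        nq_eq := rfl
        a_le := ha.trans (sum_le_sum_of_subset hsub)
        b_le := hb'.trans (sum_le_sum_of_subset hsub)
        c_le := hc.trans (sum_le_sum_of_subset hsub) }
    have h0 : Admits π (insert p (insert (π p) T))
        (Nat.lor (Nat.land (minus (minus M (cellMask p)) (cellMask (π p)))
          (Nat.lor (Nat.lor (outerMask p (π p)) (innerMask p (π p))) (Nat.lor diag flag)))
          (nextTag t p (π p))) := by
      refine ⟨fun x hx hxT => ?_, fun x hx hb => ?_⟩
      · have hlt := hS.lt x hx
        rw [mem_insert, mem_insert, not_or, not_or] at hxT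
        have h1 : π x ≠ p := by
          intro h; apply hxT.2.1; rw [← hS.inv x hx, h]
        have h2 : π x ≠ π p := by
          intro h; apply hxT.1; rw [← hS.inv x hx, h, hS.inv p hp]
        rw [testBit_lor, testBit_land, testBit_minus, testBit_minus,
          hV.admits.bit x hx hxT.2.2, testBit_cellMask hp hx (by omega),
          testBit_cellMask hq hx (by omega), testBit_lor, testBit_lor, testBit_lor,
          testBit_outerMask hp hq hx (by omega), testBit_innerMask hp hq (by omega) hlt,
          testBit_diag_pos hx (by omega)]
        by_cases h3 : π x = x
        · simp [hxT.1, hxT.2.1, h3]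
        -- Two pairs must meet: either `x` is near (outer mask) or `π x` is (inner mask).
        · rcases hS.meet p hp x hx hfix h3 with h4 | h4 <;> simp [hxT.1, hxT.2.1, h1, h2, h4]
      · rw [testBit_lor, ht, Bool.or_false, testBit_land, Bool.and_eq_true, testBit_minus,
          testBit_minus, Bool.and_eq_true, Bool.and_eq_true,
          testBit_cellMask hp hx (by omega), testBit_cellMask hq hx (by omega)] at hb
        rw [mem_insert, mem_insert, not_or, not_or]
        refine ⟨?_, ?_, hV.admits.free x hx hb.1.1.1⟩
        · rintro rfl; simp at hb
        · rintro rfl; simp at hb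
    have h1 := admits_filterC hS hT (admits_filterA hS hT h0 hrv) hrv
    obtain ⟨M', l', g1, g2, g3, g4⟩ :=
      passPair_sound hS hp hpT hfix hqT hT ds _ _ hk h1 hV.recs
    refine ⟨_, _, M', us, r :: l', ⟨g1, hT, ?_, ?_, ?_, ?_⟩, g4⟩
    · intro x hx hxT
      rw [mem_insert, mem_insert, not_or, not_or] at hxT ⊢
      refine ⟨?_, ?_, hV.closed x hx hxT.2.2⟩
      · intro h; apply hxT.2.1; rw [← hS.inv x hx, h]
      · intro h; apply hxT.1; rw [← hS.inv x hx, h, hS.inv p hp]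
    · intro x hx
      exact ⟨hsub (hV.fixed x hx).1, (hV.fixed x hx).2⟩
    · intro w
      have h3 : l'.map (fun r => w r.p + w r.q) = ds.map fun r => w r.p + w r.q := by
        have := congrArg (List.map fun z : ℕ × ℕ => w z.1 + w z.2) g3
        simpa [Function.comp_def] using this
      have h4 := hV.sum_le w
      rw [List.map_cons, List.sum_cons, h3, sum_insert hpq, sum_insert hqT]
      change _ + (w p + w (π p) + _) ≤ _
      omega
    · intro r' hr'
      rcases List.mem_cons.mp hr' with rfl | h
      · exact hrv
      · exact g2 r' h

/-! ### Soundness of the depth-first search -/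

/-- Nothing is assumed about `highBit`. A round toggles only the bit it has just tested, so a set
bit survives until its own test. -/
theorem allBits_sound {ι : Type} [Nonempty ι] {f : ι → ℕ → Bool} (n : ℕ) : ∀ {x : ℕ},
    (∀ i, allBits (f i) n x = true) → ∀ {q : ℕ}, x.testBit q = true → ∀ i, f i q = true := by
  induction n with
  | zero => intro x h; exact absurd (h (Classical.arbitrary ι)) (by simp [allBits])
  | succ n ih =>
    intro x h q hq
    have hstep : ∀ i, cond (Nat.beq x 0) true (force (highBit x) fun q => cond (f i q)
      (force (Nat.xor x (Nat.shiftLeft 1 q)) (allBits (f i) n)) false) = true := h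
    simp only [force_eq] at hstep
    have hx : Nat.beq x 0 = false := by
      rw [← Bool.not_eq_true, beq_iff]; rintro rfl; simp at hq
    simp only [hx, cond_false] at hstep
    have hf : ∀ i, f i (highBit x) = true ∧
        allBits (f i) n (Nat.xor x (Nat.shiftLeft 1 (highBit x))) = true := by
      intro i
      have := hstep i
      cases hfi : f i (highBit x) <;> simp_all
    by_cases hqx : q = highBit x
    · rw [hqx]; exact fun i => (hf i).1
    · refine ih (fun i => (hf i).2) ?_
      change (x ^^^ (1 <<< highBit x)).testBit q = true
      rw [Nat.testBit_xor, hq, Nat.one_shiftLeft, Nat.testBit_two_pow]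
      simp [Ne.symm hqx]

/-- A family of checks that cannot all succeed on a valid state. -/
def Refutes (π : ℕ → ℕ) {ι : Type} (k : ι → ℕ → ℕ → List ℕ → List Rec → Bool) : Prop :=
  ∀ T t M us ds, Valid π T M us ds → ¬ ∀ i, k i t M us ds = true

/-- The cell proposed by `strip` is arbitrary here; `isFree` certifies that it is unsettled, and
then its row contains `π p`, so one of the branches follows `π`. -/
theorem explore_sound (hS : Sol d u π) {ι : Type} [Nonempty ι]
    {base : ι → ℕ → ℕ → List ℕ → List Rec → Bool} (hbase : Refutes π base) (n : ℕ) :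
    Refutes π (fun i => explore d u (base i) n) := by
  induction n with
  | zero => exact hbase
  | succ n ih =>
    intro T t M us ds hV hk
    have hstep : ∀ i, (force (strip (Nat.land M flag) 44 (Nat.land M cand)) fun p =>
      cond (isFree M p) (allBits (fun q => assign d u t M us ds p q (explore d u (base i) n)) 43
        (row M p)) false) = true := hk
    simp only [force_eq] at hstep
    set p := strip (Nat.land M flag) 44 (Nat.land M cand)
    cases hp : isFree M p
    · exact absurd (hstep (Classical.arbitrary ι)) (by simp [hp])
    · simp only [hp, cond_true] at hstep
      obtain ⟨hp1, hp2⟩ := isFree_iff.mp hp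
      have hpT := hV.admits.free p hp1 hp2
      have hrow : (row M p).testBit (π p) = true := by
        rw [testBit_row (hS.lt p hp1)]; exact hV.admits.bit p hp1 hpT
      have := allBits_sound 43 hstep hrow
      obtain ⟨T', t', M', us', ds', hV', h⟩ := assign_sound hS hV hp1 hpT this
      exact ih T' t' M' us' ds' hV' h

theorem replay_sound (hS : Sol d u π) {ι : Type} [Nonempty ι]
    {base : ι → ℕ → ℕ → List ℕ → List Rec → Bool} (hbase : Refutes π base)
    (trail : List (ℕ × ℕ)) (ht : ∀ x ∈ trail, x.1 < 42 → π x.1 = x.2) :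
    Refutes π (fun i => replay d u (base i) trail) := by
  induction trail with
  | nil => exact hbase
  | cons x l ih =>
    intro T t M us ds hV hk
    have hstep : ∀ i, cond (isFree M x.1)
      (assign d u t M us ds x.1 x.2 (replay d u (base i) l)) false = true := hk
    cases hp : isFree M x.1
    · exact absurd (hstep (Classical.arbitrary ι)) (by simp [hp])
    · simp only [hp, cond_true] at hstep
      obtain ⟨hp1, hp2⟩ := isFree_iff.mp hp
      rw [← ht x (by simp) hp1] at hstep
      obtain ⟨T', t', M', us', ds', hV', h⟩ :=
        assign_sound hS hV hp1 (hV.admits.free _ hp1 hp2) hstep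
      exact ih (fun y hy => ht y (by simp [hy])) T' t' M' us' ds' hV' h


/-! ### Swaps of rows and columns -/

/-- The matrix `M` contains the map `π`. -/
def Matches (π : ℕ → ℕ) (M : ℕ) : Prop := ∀ x < 42, M.testBit (pos x (π x)) = true

def exchange (a s i : ℕ) : ℕ := if i = a then a + s else if i = a + s then a else i

def Swap.perm (g : Swap) (x : ℕ) : ℕ := 7 * exchange g.a g.s (x / 7) + exchange g.a' g.s' (x % 7)

def Swap.Ok (g : Swap) : Prop := g.a + g.s < 6 ∧ g.a' + g.s' < 7

theorem exchange_lt {a s n i : ℕ} (h : a + s < n) (hi : i < n) : exchange a s i < n := by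
  unfold exchange; split_ifs <;> omega

theorem exchange_exchange (a s i : ℕ) : exchange a s (exchange a s i) = i := by
  unfold exchange; split_ifs <;> omega

theorem Swap.Ok.perm_div {g : Swap} (hg : g.Ok) {x : ℕ} :
    g.perm x / 7 = exchange g.a g.s (x / 7) := by
  have := exchange_lt hg.2 (Nat.mod_lt x (by norm_num : 7 > 0))
  unfold Swap.perm; omega

theorem Swap.Ok.perm_mod {g : Swap} (hg : g.Ok) {x : ℕ} :
    g.perm x % 7 = exchange g.a' g.s' (x % 7) := by
  have := exchange_lt hg.2 (Nat.mod_lt x (by norm_num : 7 > 0))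
  unfold Swap.perm; omega

theorem Swap.Ok.perm_lt {g : Swap} (hg : g.Ok) {x : ℕ} (hx : x < 42) : g.perm x < 42 := by
  have h1 := exchange_lt hg.2 (Nat.mod_lt x (by norm_num : 7 > 0))
  have h2 := exchange_lt hg.1 (by omega : x / 7 < 6)
  unfold Swap.perm; omega

theorem Swap.Ok.perm_perm {g : Swap} (hg : g.Ok) (x : ℕ) : g.perm (g.perm x) = x := by
  rw [Swap.perm, hg.perm_div, hg.perm_mod, exchange_exchange, exchange_exchange]; omega

theorem testBit_blockSwap (m s x j : ℕ) : (blockSwap m s x).testBit j =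
    ((x.testBit j && !(m.testBit j || (decide (s ≤ j) && m.testBit (j - s)))) ||
      ((x.testBit (s + j) && m.testBit j) ||
        (decide (s ≤ j) && (x.testBit (j - s) && m.testBit (j - s))))) := by
  simp only [blockSwap, testBit_lor, testBit_minus, testBit_land, testBit_shiftLeft,
    testBit_shiftRight]

/-- A block swap moves bit `j'` to bit `j` if `m` marks `j` or `j - s` accordingly. -/
theorem testBit_blockSwap_of {m s M j j' : ℕ}
    (h : (m.testBit j = true ∧ j' = j + s ∧ (s ≤ j → m.testBit (j - s) = true → s = 0)) ∨
      (m.testBit j = false ∧ s ≤ j ∧ m.testBit (j - s) = true ∧ j' = j - s) ∨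
      (m.testBit j = false ∧ (s ≤ j → m.testBit (j - s) = false) ∧ j' = j)) :
    (blockSwap m s M).testBit j = M.testBit j' := by
  rw [testBit_blockSwap]
  rcases h with ⟨h1, rfl, h2⟩ | ⟨h1, h2, h3, rfl⟩ | ⟨h1, h2, h3⟩
  · rw [h1, add_comm s j]
    by_cases hs : s ≤ j
    · cases hm : m.testBit (j - s)
      · simp
      · have := h2 hs hm
        subst this; simp
    · simp [hs]
  · simp [h1, h2, h3]
  · rw [h3]
    by_cases hs : s ≤ j
    · simp [h1, h2 hs]
    · simp [h1, hs]

theorem testBit_swap_outerRow {a s x e : ℕ} (M : ℕ) (h : a + s < 6) (hx : x < 42) (he : e < 43) :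
    (blockSwap (Nat.shiftLeft outerRow (Nat.mul 301 a)) (Nat.mul 301 s) M).testBit (pos x e) =
      M.testBit (pos (7 * exchange a s (x / 7) + x % 7) e) := by
  apply testBit_blockSwap_of
  simp only [testBit_outerRow_shift]
  simp only [Nat.mul_eq, pos, exchange, decide_eq_true_eq, decide_eq_false_iff_not]
  split_ifs <;> omega

theorem testBit_outerCol_field {a e : ℕ} (he : e < 43) :
    (Nat.shiftLeft outerCol (Nat.mul 43 a)).testBit e = false := by
  rw [testBit_shiftLeft, testBit_outerCol, ← Bool.not_eq_true]
  simp only [Bool.and_eq_true, decide_eq_true_eq, beq_iff_eq, Nat.mul_eq]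
  omega

theorem testBit_swap_outerCol {a s x e : ℕ} (M : ℕ) (h : a + s < 7) (hx : x < 42) (he : e < 43) :
    (blockSwap (Nat.shiftLeft outerCol (Nat.mul 43 a)) (Nat.mul 43 s) M).testBit (pos x e) =
      M.testBit (pos (7 * (x / 7) + exchange a s (x % 7)) e) := by
  have key : Nat.mul 43 s ≤ pos x e →
      ((Nat.shiftLeft outerCol (Nat.mul 43 a)).testBit (pos x e - Nat.mul 43 s) = true ↔
        x % 7 = a + s) := by
    intro hs
    simp only [Nat.mul_eq] at hs ⊢
    rcases le_or_gt s x with h1 | h1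
    · have : pos x e - 43 * s = pos (x - s) e := by simp only [pos]; omega
      have h2 := testBit_outerCol_shift (a := a) (x := x - s) (e := e) (by omega) (by omega) he
      rw [Nat.mul_eq] at h2
      rw [this, h2, beq_iff_eq]
      omega
    · have : pos x e - 43 * s = e := by simp only [pos] at hs ⊢; omega
      have h2 := testBit_outerCol_field (a := a) he
      rw [Nat.mul_eq] at h2
      rw [this, h2]
      simp only [Bool.false_eq_true, false_iff]
      omega
  apply testBit_blockSwap_of
  have h0 := testBit_outerCol_shift (a := a) (by omega) hx he
  simp only [← Bool.not_eq_true, h0, beq_iff_eq]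
  by_cases h1 : x % 7 = a
  · refine Or.inl ⟨h1, ?_, fun hs hm => ?_⟩
    · simp only [pos, exchange, h1, if_true, Nat.mul_eq]; omega
    · have := (key hs).mp hm
      simp only [Nat.mul_eq]; omega
  · by_cases h2 : x % 7 = a + s
    · have hs : Nat.mul 43 s ≤ pos x e := by simp only [pos, Nat.mul_eq]; omega
      refine Or.inr (Or.inl ⟨h1, hs, (key hs).mpr h2, ?_⟩)
      simp only [pos, exchange, h2, if_true, Nat.mul_eq]
      split_ifs <;> omega
    · refine Or.inr (Or.inr ⟨h1, fun hs => by rwa [key hs], ?_⟩)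
      simp only [pos, exchange, h1, h2, if_false]; omega

theorem testBit_swap_innerRow {a s x e : ℕ} (M : ℕ) (h : a + s < 6) (hx : x < 42) (he : e < 42) :
    (blockSwap (Nat.shiftLeft innerRow (Nat.mul 7 a)) (Nat.mul 7 s) M).testBit (pos x e) =
      M.testBit (pos x (7 * exchange a s (e / 7) + e % 7)) := by
  have key : Nat.mul 7 s ≤ pos x e →
      ((Nat.shiftLeft innerRow (Nat.mul 7 a)).testBit (pos x e - Nat.mul 7 s) = true ↔
        e / 7 = a + s) := by
    intro hs
    simp only [Nat.mul_eq] at hs ⊢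
    rcases le_or_gt (7 * s) e with h1 | h1
    · have : pos x e - 7 * s = 43 * (x + 1) + (e - 7 * s) := by simp only [pos]; omega
      have h2 := testBit_innerRow_shift (a := a) (x := x + 1) (e := e - 7 * s)
        (by omega) (by omega) (by omega)
      rw [Nat.mul_eq] at h2
      rw [this, h2, Bool.and_eq_true, beq_iff_eq, decide_eq_true_eq]
      omega
    · have : pos x e - 7 * s = 43 * x + (43 + e - 7 * s) := by simp only [pos]; omega
      have h2 := testBit_innerRow_shift (a := a) (x := x) (e := 43 + e - 7 * s)
        (by omega) (by omega) (by omega)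
      rw [Nat.mul_eq] at h2
      rw [this, h2, Bool.and_eq_true, beq_iff_eq, decide_eq_true_eq]
      omega
  apply testBit_blockSwap_of
  have h0 := testBit_innerRow_shift (a := a) (x := x + 1) (e := e) (by omega) (by omega) (by omega)
  simp only [← Bool.not_eq_true, h0, beq_iff_eq, Bool.and_eq_true, decide_eq_true_eq, he, and_true]
  by_cases h1 : e / 7 = a
  · refine Or.inl ⟨h1, ?_, fun hs hm => ?_⟩
    · simp only [pos, exchange, h1, if_true, Nat.mul_eq]; omega
    · have := (key hs).mp hm
      simp only [Nat.mul_eq]; omega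
  · by_cases h2 : e / 7 = a + s
    · have hs : Nat.mul 7 s ≤ pos x e := by simp only [pos, Nat.mul_eq]; omega
      refine Or.inr (Or.inl ⟨h1, hs, (key hs).mpr h2, ?_⟩)
      simp only [pos, exchange, h2, if_true, Nat.mul_eq]
      split_ifs <;> omega
    · refine Or.inr (Or.inr ⟨h1, fun hs => by rwa [key hs], ?_⟩)
      simp only [pos, exchange, h1, h2, if_false]; omega

theorem testBit_swap_innerCol {a s x e : ℕ} (M : ℕ) (h : a + s < 7) (hx : x < 42) (he : e < 42) :
    (blockSwap (Nat.shiftLeft innerCol a) s M).testBit (pos x e) =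
      M.testBit (pos x (7 * (e / 7) + exchange a s (e % 7))) := by
  have key : s ≤ pos x e →
      ((Nat.shiftLeft innerCol a).testBit (pos x e - s) = true ↔ e % 7 = a + s) := by
    intro hs
    rcases le_or_gt s e with h1 | h1
    · have : pos x e - s = 43 * (x + 1) + (e - s) := by simp only [pos]; omega
      rw [this, testBit_innerCol_shift (by omega) (by omega) (by omega), Bool.and_eq_true,
        beq_iff_eq, decide_eq_true_eq]
      omega
    · have : pos x e - s = 43 * x + (43 + e - s) := by simp only [pos]; omega
      rw [this, testBit_innerCol_shift (by omega) (by omega) (by omega), Bool.and_eq_true,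
        beq_iff_eq, decide_eq_true_eq]
      omega
  apply testBit_blockSwap_of
  have h0 := testBit_innerCol_shift (a := a) (x := x + 1) (e := e) (by omega) (by omega) (by omega)
  simp only [← Bool.not_eq_true, h0, beq_iff_eq, Bool.and_eq_true, decide_eq_true_eq, he, and_true]
  by_cases h1 : e % 7 = a
  · refine Or.inl ⟨h1, ?_, fun hs hm => ?_⟩
    · simp only [pos, exchange, h1, if_true]; omega
    · have := (key hs).mp hm
      omega
  · by_cases h2 : e % 7 = a + s
    · have hs : s ≤ pos x e := by simp only [pos]; omega
      refine Or.inr (Or.inl ⟨h1, hs, (key hs).mpr h2, ?_⟩)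
      simp only [pos, exchange, h2, if_true]
      split_ifs <;> omega
    · refine Or.inr (Or.inr ⟨h1, fun hs => by rwa [key hs], ?_⟩)
      simp only [pos, exchange, h1, h2, if_false]; omega

theorem testBit_act {g : Swap} (hg : g.Ok) (M : ℕ) {x e : ℕ} (hx : x < 42) (he : e < 42) :
    (g.act M).testBit (pos x e) = M.testBit (pos (g.perm x) (g.perm e)) := by
  have hx' := exchange_lt hg.1 (by omega : x / 7 < 6)
  have he' := exchange_lt hg.1 (by omega : e / 7 < 6)
  unfold Swap.act
  rw [testBit_swap_outerRow _ hg.1 hx (by omega),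
    testBit_swap_innerRow _ hg.1 (by omega) he,
    testBit_swap_outerCol _ hg.2 (by omega) (by omega),
    testBit_swap_innerCol _ hg.2
      (by have := exchange_lt hg.2 (Nat.mod_lt (7 * exchange g.a g.s (x / 7) + x % 7)
            (by norm_num : 7 > 0)); omega) (by omega)]
  have h1 : ∀ y z : ℕ, (7 * y + z % 7) / 7 = y := by omega
  have h2 : ∀ y z : ℕ, (7 * y + z % 7) % 7 = z % 7 := by omega
  rw [h1, h2, h1, h2]
  rfl

def Swap.conj (g : Swap) (π : ℕ → ℕ) : ℕ → ℕ := fun x => g.perm (π (g.perm x))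

theorem Matches.conj {g : Swap} (hg : g.Ok) {π : ℕ → ℕ} (hπ : ∀ x < 42, π x < 42) {M : ℕ}
    (h : Matches π M) (hM : g.act M = M) : Matches (g.conj π) M := by
  intro x hx
  have hx' := hg.perm_lt hx
  have h1 := testBit_act hg M hx (hg.perm_lt (hπ _ hx'))
  rw [hM, hg.perm_perm] at h1
  exact h1.trans (h _ hx')

theorem mem_stabilizer {M : ℕ} {l : List Swap} {g : Swap} (h : g ∈ stabilizer M l) :
    g ∈ l ∧ g.act M = M := by
  induction l with
  | nil => exact absurd h (by simp [stabilizer])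
  | cons g' l ih =>
    have heq : stabilizer M (g' :: l) =
      cond (Nat.beq (g'.act M) M) (g' :: stabilizer M l) (stabilizer M l) := rfl
    rw [heq] at h
    cases hb : Nat.beq (g'.act M) M
    · rw [hb] at h
      exact ⟨List.mem_cons_of_mem _ (ih h).1, (ih h).2⟩
    · rw [hb] at h
      rcases List.mem_cons.mp h with rfl | h
      · exact ⟨by simp, beq_iff.mp hb⟩
      · exact ⟨List.mem_cons_of_mem _ (ih h).1, (ih h).2⟩

/-! ### Branching with symmetry reduction -/

section

variable {d u : ℕ} {P : (ℕ → ℕ) → Prop}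

/-- No pairing with property `P` that matches `M` uses a pair marked in `B`. -/
def Avoids (P : (ℕ → ℕ) → Prop) (M B : ℕ) : Prop :=
  ∀ π, P π → Matches π M → ∀ x < 42, B.testBit (pos x (π x)) = false

/-- If `π` used a pair of `g.act B`, its conjugate by `g` would use a pair of `B`. The conjugate
still has property `P` and still matches `M`, because `g` fixes `M`. -/
theorem Avoids.spread (hP : ∀ π, P π → Sol d u π)
    (hsym : ∀ g : Swap, g.Ok → ∀ π, P π → P (g.conj π)) {M : ℕ} (H : List Swap)
    (hH : ∀ g ∈ H, g.Ok ∧ g.act M = M) : ∀ {B : ℕ}, Avoids P M B → Avoids P M (spread H B) := by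
  induction H with
  | nil => exact fun h => h
  | cons g l ih =>
    intro B h
    have heq : GridSearch.spread (g :: l) B =
      force (Nat.lor B (g.act B)) (GridSearch.spread l) := rfl
    rw [heq, force_eq]
    refine ih (fun g' hg' => hH g' (by simp [hg'])) ?_
    intro π hπ hm x hx
    obtain ⟨hg, hgM⟩ := hH g (by simp)
    have hlt := (hP π hπ).lt
    have h1 := h _ (hsym g hg π hπ) (hm.conj hg hlt hgM) (g.perm x) (hg.perm_lt hx)
    rw [Swap.conj, hg.perm_perm] at h1
    rw [testBit_lor, h π hπ hm x hx, testBit_act hg B hx (hlt x hx), h1]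
    rfl

theorem testBit_pairBits {p q x e : ℕ} (hp : p < 42) (hq : q < 42) (he : e < 42) :
    (pairBits p q).testBit (pos x e) = ((x == p && e == q) || (x == q && e == p)) := by
  have h : ∀ s j, (Nat.shiftLeft 1 s).testBit j = decide (j = s) := by
    intro s j
    rw [Nat.shiftLeft_eq', Nat.one_shiftLeft, Nat.testBit_two_pow]
    simp [eq_comm]
  rw [pairBits, testBit_lor, h, h, Bool.eq_iff_iff]
  simp only [pos, Bool.or_eq_true, Bool.and_eq_true, decide_eq_true_eq, beq_iff_eq, Nat.mul_eq,
    Nat.add_eq]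
  omega

theorem Matches.assignBits {π : ℕ → ℕ} (hS : Sol d u π) {M p : ℕ} (hp : p < 42)
    (h : Matches π M) : Matches π (assignBits M p (π p)) := by
  intro x hx
  have hq := hS.lt p hp
  have hlt := hS.lt x hx
  have hflag : flag.testBit (pos x (π x)) = false := by
    rw [testBit_flag_pos hx (by omega)]; simp; omega
  have hxp : π x = p → x = π p := by rintro rfl; exact (hS.inv x hx).symm
  have hxq : π x = π p → x = p := by
    intro h; rw [← hS.inv x hx, h, hS.inv p hp]
  unfold GridSearch.assignBits
  cases hb : Nat.beq p (π p)
  · simp only [cond_false, testBit_land, testBit_minus, testBit_lor, h x hx,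
      testBit_cellMask hp hx (show π x < 43 by omega), testBit_cellMask hq hx (show π x < 43 by omega),
      hflag, testBit_pairBits hp hq hlt, testBit_outerMask hp hq hx (show π x < 43 by omega),
      testBit_innerMask hp hq (show x + 1 ≤ 42 by omega) hlt,
      testBit_diag_pos hx (show π x < 43 by omega)]
    have hne : π p ≠ p := by
      intro h; rw [h, Nat.beq_refl] at hb; exact absurd hb (by simp)
    by_cases h1 : x = p
    · subst h1; simp [near_self]
    · by_cases h2 : x = π p
      · have h3 : π x = p := by rw [h2, hS.inv p hp]
        rw [h3, ← h2]; simp [near_right]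
      · have h3 : π x ≠ p := fun h => h2 (hxp h)
        have h4 : π x ≠ π p := fun h => h1 (hxq h)
        by_cases h5 : π x = x
        · simp [h1, h2, h5]
        · rcases hS.meet p hp x hx hne h5 with h6 | h6 <;> simp [h1, h2, h3, h4, h6]
  · have hfix : π p = p := (beq_iff.mp hb).symm
    rw [cond_true, hfix, testBit_minus, h x hx, testBit_minus, testBit_lor,
      testBit_cellMask hp hx (show π x < 43 by omega), hflag, testBit_pairBits hp hp hlt]
    by_cases h1 : x = p
    · subst h1; simp [hfix]
    · have h2 : π x ≠ p := by intro h; exact h1 ((hxp h).trans hfix)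
      simp [h1, h2]

theorem branch_succ (child : ℕ → ℕ → ℕ → Bool) (leaf : ℕ → Bool) (H : List Swap) (n M : ℕ) :
    branch child leaf H (n + 1) M =
      (force (strip flag 1 (Nat.land M cand)) fun p => cond (Nat.beq p 42)
      (force (strip (Nat.land flag (Nat.add (Nat.land (Nat.land M cand)
          (Nat.sub (Nat.land M cand) (Nat.shiftRight flag 42))) ones)) 44 (Nat.land M cand)) fun p =>
        cond (Nat.ble p 41)
          (force (minus (row M p) (Nat.shiftLeft 1 p)) fun x =>
            force (cond (Nat.beq x 0) p (highBit x)) fun q =>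
            cond (Nat.ble q 41)
             (cond (child p q (assignBits M p q))
              (force (spread H (spread H (spread H
                (Nat.lor (Nat.mod M (2 ^ 41 - 21)) (pairBits p q)))))
                fun B => force (minus M B) (branch child leaf H n)) false) false)
          (leaf M))
      (cond (Nat.ble p 41) (Nat.beq (row M p) 0) false)) := rfl

/-- Replaces the heuristic choices by arbitrary numbers that depend on neither `child` nor `leaf`,
hence are common to all shares. -/
theorem exists_branch_succ (H : List Swap) (M : ℕ) : ∃ p₀ p q : ℕ, ∀ child leaf n,
    branch child leaf H (n + 1) M = cond (Nat.beq p₀ 42)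
      (cond (Nat.ble p 41) (cond (Nat.ble q 41) (cond (child p q (assignBits M p q))
        (branch child leaf H n (minus M (spread H (spread H (spread H
          (Nat.lor (Nat.mod M (2 ^ 41 - 21)) (pairBits p q))))))) false) false) (leaf M))
      (cond (Nat.ble p₀ 41) (Nat.beq (row M p₀) 0) false) := by
  have h := fun child leaf n => branch_succ child leaf H n M
  simp only [force_eq] at h
  exact ⟨_, _, _, h⟩

/-- Two matrices are kept: `M₀`, fixed by the swaps in `H`, and the shrinking `M`. Deletions may
break the symmetry of `M`, but they lose no map that matches `M₀`, and orbits are taken relative to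
`M₀`. -/
theorem branch_sound (hP : ∀ π, P π → Sol d u π)
    (hsym : ∀ g : Swap, g.Ok → ∀ π, P π → P (g.conj π)) {ι : Type} [Nonempty ι]
    {child : ι → ℕ → ℕ → ℕ → Bool} {leaf : ι → ℕ → Bool} {H : List Swap} {M₀ : ℕ}
    (hH : ∀ g ∈ H, g.Ok ∧ g.act M₀ = M₀)
    (hchild : ∀ p q M, (∀ i, child i p q M = true) → ∀ π, P π → ¬ Matches π M)
    (hleaf : ∀ M, (∀ i, leaf i M = true) → ∀ π, P π → ¬ Matches π M) (n : ℕ) :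
    ∀ {M : ℕ}, (∀ i, branch (child i) (leaf i) H n M = true) →
    (∀ π, P π → Matches π M₀ → Matches π M) → ∀ π, P π → ¬ Matches π M₀ := by
  induction n with
  | zero => exact fun h => absurd (h (Classical.arbitrary ι)) (by simp [branch])
  | succ n ih =>
    intro M h hM π hπ hm
    obtain ⟨p₀, p, q, hstep⟩ := exists_branch_succ H M
    simp only [hstep] at h
    have h0 := h (Classical.arbitrary ι)
    cases hp₀ : Nat.beq p₀ 42
    · simp only [hp₀, cond_false] at h0
      cases hp : Nat.ble p₀ 41
      · rw [hp] at h0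
        cases h0
      · simp only [hp, cond_true] at h0
        have hlt : p₀ < 42 := Nat.lt_succ_of_le (Nat.le_of_ble_eq_true hp)
        have h1 := hM π hπ hm p₀ hlt
        rw [← testBit_row ((hP π hπ).lt p₀ hlt), beq_iff.mp h0, Nat.zero_testBit] at h1
        cases h1
    · simp only [hp₀, cond_true] at h h0
      cases hp : Nat.ble p 41
      · simp only [hp, cond_false] at h
        exact hleaf M h π hπ (hM π hπ hm)
      · simp only [hp, cond_true] at h h0
        have hp' : p < 42 := Nat.lt_succ_of_le (Nat.le_of_ble_eq_true hp)
        cases hq : Nat.ble q 41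
        · rw [hq] at h0
          cases h0
        · simp only [hq, cond_true] at h
          have hq' : q < 42 := Nat.lt_succ_of_le (Nat.le_of_ble_eq_true hq)
          have hc : ∀ i, child i p q (assignBits M p q) = true := by
            intro i
            have := h i
            cases hci : child i p q (assignBits M p q)
            · rw [hci] at this
              cases this
            · rfl
          simp only [hc, cond_true] at h
          refine ih h ?_ π hπ hm
          have hav : Avoids P M₀ (Nat.lor (Nat.mod M (2 ^ 41 - 21)) (pairBits p q)) := by
            intro σ hσ hσm x hx
            have hσS := hP σ hσ
            have hne : σ p ≠ q := by
              intro he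
              have := (hM σ hσ hσm).assignBits hσS hp'
              rw [he] at this
              exact hchild p q _ hc σ hσ this
            have ht : (Nat.mod M (2 ^ 41 - 21)).testBit (pos x (σ x)) = false := by
              have : Nat.mod M (2 ^ 41 - 21) < 2 ^ 41 :=
                (Nat.mod_lt M (by norm_num)).trans (by norm_num)
              exact testBit_tag this
            rw [testBit_lor, ht, Bool.false_or, testBit_pairBits hp' hq' (hσS.lt x hx),
              ← Bool.not_eq_true]
            simp only [Bool.or_eq_true, Bool.and_eq_true, beq_iff_eq]
            rintro (⟨rfl, h2⟩ | ⟨h1, h2⟩)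
            · exact hne h2
            · apply hne; rw [← h2, hσS.inv x hx, h1]
          have hav := ((hav.spread hP hsym H hH).spread hP hsym H hH).spread hP hsym H hH
          intro σ hσ hσm x hx
          rw [testBit_minus, hM σ hσ hσm x hx, hav σ hσ hσm x hx]
          rfl

theorem shallow_sound (hP : ∀ π, P π → Sol d u π)
    (hsym : ∀ g : Swap, g.Ok → ∀ π, P π → P (g.conj π)) {ι : Type} [Nonempty ι]
    {leaf : ι → ℕ → List (ℕ × ℕ) → Bool} {G : List Swap} (hG : ∀ g ∈ G, g.Ok)
    (hleaf : ∀ M tr, (∀ i, leaf i M tr = true) → ∀ π, P π → ¬ Matches π M) (n : ℕ) :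
    ∀ {M : ℕ} {tr : List (ℕ × ℕ)}, (∀ i, shallow (leaf i) G n M tr = true) →
    ∀ π, P π → ¬ Matches π M := by
  induction n with
  | zero => intro M tr h; exact hleaf M tr h
  | succ n ih =>
    intro M tr h
    have hstep : ∀ i, force M (fun M => branch (fun p q M => shallow (leaf i) G n M ((p, q) :: tr))
      (fun M => leaf i M tr) (stabilizer M G) 300 M) = true := h
    simp only [force_eq] at hstep
    refine branch_sound hP hsym (fun g hg => ⟨hG g (mem_stabilizer hg).1, (mem_stabilizer hg).2⟩)
      (fun p q M hc => ih hc) (fun M hl => hleaf M tr hl) 300 hstep (fun _ _ hm => hm)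

theorem singles_sound {π : ℕ → ℕ} (hlt : ∀ x < 42, π x < 42) {M : ℕ} (hm : Matches π M)
    {l : List (ℕ × ℕ)} (h : singles M l = true) : ∀ x ∈ l, x.1 < 42 → π x.1 = x.2 := by
  induction l with
  | nil => simp
  | cons y l ih =>
    have hstep : cond (Nat.beq (row M y.1) (Nat.shiftLeft 1 y.2)) (singles M l) false = true := h
    cases hb : Nat.beq (row M y.1) (Nat.shiftLeft 1 y.2)
    · rw [hb, cond_false] at hstep
      cases hstep
    · rw [hb, cond_true] at hstep
      intro x hx hx1
      rcases List.mem_cons.mp hx with rfl | hx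
      · have h1 := hm x.1 hx1
        rw [← testBit_row (hlt _ hx1), beq_iff.mp hb, Nat.shiftLeft_eq', Nat.one_shiftLeft,
          Nat.testBit_two_pow] at h1
        exact (of_decide_eq_true h1).symm
      · exact ih hstep x hx hx1

/-- The shares agree up to the middle of the search. A valid state there with tag `t` is refuted in
full by share `t % K`, so all shares together leave none. -/
theorem leafCheck_sound {m K : ℕ} (hK : 0 < K) {M : ℕ} {tr : List (ℕ × ℕ)}
    (h : ∀ i : Fin K, leafCheck d u m K i M tr = true) {π : ℕ → ℕ} (hS : Sol d u π) :
    ¬ Matches π M := by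
  intro hm
  have : Nonempty (Fin K) := ⟨⟨0, hK⟩⟩
  cases hs : singles M tr
  · have := h ⟨0, hK⟩
    simp [leafCheck, hs] at this
  · simp only [leafCheck, hs, cond_true] at h
    have hbase : Refutes π (fun (_ : Unit) (_ _ : ℕ) (_ : List ℕ) (_ : List Rec) => false) :=
      fun T t M us ds _ hk => absurd (hk ()) (by simp)
    have hmid : Refutes π (fun (i : Fin K) t M us ds => cond (Nat.beq (Nat.mod t K) i)
        (explore d u (fun _ _ _ _ => false) 43 t M us ds) true) := by
      intro T t M us ds hV hk
      have h1 := hk ⟨t % K, Nat.mod_lt t hK⟩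
      have h2 : Nat.beq (Nat.mod t K) (t % K) = true := beq_iff.mpr rfl
      simp only [h2, cond_true] at h1
      exact explore_sound hS hbase 43 T t M us ds hV fun _ => h1
    refine replay_sound hS (explore_sound hS hmid m) tr (singles_sound hS.lt hm hs) ∅ 1 M [] []
      ⟨⟨fun x hx _ => hm x hx, by simp⟩, by simp, by simp, by simp, by simp, by simp⟩ h

set_option maxRecDepth 100000 in
theorem initial_matches {π : ℕ → ℕ} (hS : Sol d u π) : Matches π initial := by
  have h : ∀ x < 42, ∀ e < 42, (e = x ∨ (e / 7 ≠ x / 7 ∧ e % 7 ≠ x % 7)) →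
      initial.testBit (pos x e) = true := by
    decide +kernel
  intro x hx
  refine h x hx _ (hS.lt x hx) ?_
  by_cases hf : π x = x
  · exact Or.inl hf
  · exact Or.inr (hS.apart x hx hf)

theorem run_sound (hP : ∀ π, P π → Sol d u π)
    (hsym : ∀ g : Swap, g.Ok → ∀ π, P π → P (g.conj π)) {m K : ℕ} (hK : 0 < K)
    (h : ∀ i : Fin K, run d u m K i = true) (π : ℕ → ℕ) : ¬ P π := by
  intro hπ
  have : Nonempty (Fin K) := ⟨⟨0, hK⟩⟩
  have hG : ∀ g ∈ swaps, g.Ok := by unfold Swap.Ok; decide +kernel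
  exact shallow_sound (leaf := fun i : Fin K => leafCheck d u m K i) hP hsym hG
    (fun M tr hl σ hσ => leafCheck_sound hK hl (hP σ hσ)) 3 h π hπ (initial_matches (hP π hπ))

end


/-! ### From colourings to the counting constraints -/

/-- A proper complete colouring `h` of the cells with a set `D` of `d` colours that are used exactly
twice, `u` other colours, and the map `π` exchanging the two cells of each colour in `D`. -/
structure Arrangement {C : Type} [Fintype C] [DecidableEq C] (d u : ℕ) (h : ℕ → C) (D : Finset C)
    (π : ℕ → ℕ) : Prop where
  card : #D = d
  card_compl : #Dᶜ = u
  surj : ∀ c, ∃ x < 42, h x = c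
  proper : ∀ x < 42, ∀ y < 42, x ≠ y → h x = h y → x / 7 ≠ y / 7 ∧ x % 7 ≠ y % 7
  complete : ∀ c c', c ≠ c' → ∃ x < 42, ∃ y < 42, h x = c ∧ h y = c' ∧ (x / 7 = y / 7 ∨ x % 7 = y % 7)
  lt : ∀ x < 42, π x < 42
  pair : ∀ x < 42, h x ∈ D → π x ≠ x ∧ h (π x) = h x ∧ ∀ y < 42, h y = h x → y = x ∨ y = π x
  fixed : ∀ x < 42, h x ∉ D → π x = x

theorem near_iff {p q y : ℕ} : near p q y = true ↔
    y / 7 = p / 7 ∨ y / 7 = q / 7 ∨ y % 7 = p % 7 ∨ y % 7 = q % 7 := by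
  simp [near, or_assoc]

theorem card_near {p q : ℕ} (hp : p < 42) (hq : q < 42) (h : q / 7 ≠ p / 7 ∧ q % 7 ≠ p % 7) :
    ∑ y ∈ range 42, (if y ≠ p ∧ y ≠ q ∧ near p q y then 1 else 0) = 20 := by
  have key : ∀ p < 42, ∀ q < 42, (q / 7 ≠ p / 7 ∧ q % 7 ≠ p % 7) →
      ∑ y ∈ range 42, (if y ≠ p ∧ y ≠ q ∧ near p q y then 1 else 0) = 20 := by decide +kernel
  exact key p hp q hq h

variable {C : Type} [Fintype C] [DecidableEq C] {d u : ℕ} {h : ℕ → C} {D : Finset C} {π : ℕ → ℕ}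

namespace Arrangement

theorem mem_iff (A : Arrangement d u h D π) {x : ℕ} (hx : x < 42) : h x ∈ D ↔ π x ≠ x :=
  ⟨fun hD => (A.pair x hx hD).1, fun hne => by_contra fun hD => hne (A.fixed x hx hD)⟩

theorem inv (A : Arrangement d u h D π) {x : ℕ} (hx : x < 42) : π (π x) = x := by
  by_cases hD : h x ∈ D
  · obtain ⟨_, h2, h3⟩ := A.pair x hx hD
    have hlt := A.lt x hx
    obtain ⟨h4, h5, _⟩ := A.pair (π x) hlt (h2 ▸ hD)
    rcases h3 _ (A.lt _ hlt) (h5.trans h2) with h6 | h6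
    · exact h6
    · exact absurd h6 h4
  · rw [A.fixed x hx hD, A.fixed x hx hD]

theorem apart (A : Arrangement d u h D π) {x : ℕ} (hx : x < 42) (hne : π x ≠ x) :
    π x / 7 ≠ x / 7 ∧ π x % 7 ≠ x % 7 :=
  A.proper _ (A.lt x hx) x hx hne (A.pair x hx ((A.mem_iff hx).mpr hne)).2.1

/-- The colour of `x` occurs only on `x` and `π x`, so completeness puts each other colour on a line
through one of them. -/
theorem exists_near (A : Arrangement d u h D π) {x : ℕ} (hx : x < 42) (hne : π x ≠ x) {c : C}
    (hc : h x ≠ c) : ∃ y < 42, h y = c ∧ y ≠ x ∧ y ≠ π x ∧ near x (π x) y = true := by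
  obtain ⟨x', hx', y, hy, h1, h2, h3⟩ := A.complete _ _ hc
  obtain ⟨_, h4, h5⟩ := A.pair x hx ((A.mem_iff hx).mpr hne)
  refine ⟨y, hy, h2, ?_, ?_, ?_⟩
  · rintro rfl; exact hc h2
  · rintro rfl; exact hc (h4.symm.trans h2)
  · rw [near_iff]
    rcases h5 x' hx' h1 with rfl | rfl <;> omega

theorem meet (A : Arrangement d u h D π) {x y : ℕ} (hx : x < 42) (hy : y < 42) (hxne : π x ≠ x)
    (hyne : π y ≠ y) : near x (π x) y = true ∨ near x (π x) (π y) = true := by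
  by_cases hc : h x = h y
  · rcases (A.pair x hx ((A.mem_iff hx).mpr hxne)).2.2 y hy hc.symm with rfl | rfl
    · exact Or.inl (near_self _ _)
    · exact Or.inl (near_right _ _)
  · obtain ⟨z, hz, h1, _, _, h2⟩ := A.exists_near hx hxne hc
    rcases (A.pair y hy ((A.mem_iff hy).mpr hyne)).2.2 z hz h1 with rfl | rfl
    · exact Or.inl h2
    · exact Or.inr h2

theorem card_moved (A : Arrangement d u h D π) : #{x ∈ range 42 | π x ≠ x} = 2 * d := by
  rw [card_eq_sum_card_fiberwise (f := h) (t := D)]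
  · rw [← A.card, mul_comm, ← smul_eq_mul, ← sum_const]
    apply sum_congr rfl
    intro c hc
    obtain ⟨x, hx, rfl⟩ := A.surj c
    obtain ⟨h1, h2, h3⟩ := A.pair x hx hc
    rw [← card_pair h1.symm]
    congr 1
    ext y
    simp only [mem_filter, mem_range, mem_insert, mem_singleton]
    constructor
    · rintro ⟨⟨hy, _⟩, hyx⟩
      exact h3 y hy hyx
    · rintro (rfl | rfl)
      · exact ⟨⟨hx, h1⟩, rfl⟩
      · exact ⟨⟨A.lt x hx, by rw [A.inv hx]; exact h1.symm⟩, h2⟩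
  · intro x hx
    simp only [coe_filter, mem_range, Set.mem_ofPred_eq] at hx
    exact (A.mem_iff hx.1).mpr hx.2

theorem sum_fixed (A : Arrangement d u h D π) :
    ∑ y ∈ range 42, (if π y = y then 1 else 0) + 2 * d = 42 := by
  rw [← card_filter, ← A.card_moved, card_filter_add_card_filter_not, card_range]

theorem sum_line_le (A : Arrangement d u h D π) {p : ℕ → Prop} [DecidablePred p]
    (hp : ∀ x y, p x → p y → x / 7 = y / 7 ∨ x % 7 = y % 7) :
    ∑ y ∈ range 42, (if π y = y ∧ p y then 1 else 0) ≤ u := by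
  rw [← card_filter, ← A.card_compl]
  apply card_le_card_of_injOn h
  · intro x hx
    simp only [coe_filter, mem_range, Set.mem_ofPred_eq] at hx
    rw [mem_coe, mem_compl, A.mem_iff hx.1]
    exact not_not.mpr hx.2.1
  · intro x hx y hy hxy
    simp only [coe_filter, mem_range, Set.mem_ofPred_eq] at hx hy
    by_contra hne
    have := A.proper x hx.1 y hy.1 hne hxy
    rcases hp x y hx.2.2 hy.2.2 with h | h
    · exact this.1 h
    · exact this.2 h

theorem le_sum_near_fixed (A : Arrangement d u h D π) {x : ℕ} (hx : x < 42) (hne : π x ≠ x) :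
    u ≤ ∑ y ∈ range 42, (if π y = y ∧ near x (π x) y = true then 1 else 0) := by
  rw [← card_filter, ← A.card_compl]
  refine (card_le_card fun c hc => ?_).trans (card_image_le (f := h))
  have hxc : h x ≠ c := by
    rintro rfl
    exact mem_compl.mp hc ((A.mem_iff hx).mpr hne)
  obtain ⟨y, hy, h1, _, _, h2⟩ := A.exists_near hx hne hxc
  exact mem_image.mpr ⟨y, by simp [hy, h2, A.fixed y hy (h1 ▸ mem_compl.mp hc)], h1⟩

/-- By `meet`, each of the `d - 1` other pairs contributes exactly 2: one from each cell if both are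
near, otherwise 2 from the single near cell. The summand 2 on the right accounts for the pair `{x, π
x}` itself. -/
theorem le_sum_near_moved (A : Arrangement d u h D π) {x : ℕ} (hx : x < 42) (hne : π x ≠ x) :
    2 * d ≤ ∑ y ∈ range 42, (if y ≠ x ∧ y ≠ π x ∧ near x (π x) y = true ∧ π y ≠ y then
      (if near x (π x) (π y) = true then 1 else 2) else 0) + 2 := by
  set v : ℕ → ℕ := fun y => if y ≠ x ∧ y ≠ π x ∧ near x (π x) y = true ∧ π y ≠ y then
      (if near x (π x) (π y) = true then 1 else 2) else 0
  set S := {y ∈ range 42 | π y ≠ y} \ {x, π x} with hS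
  have hmem : ∀ {y}, y ∈ S ↔ y < 42 ∧ π y ≠ y ∧ y ≠ x ∧ y ≠ π x := by
    intro y
    simp only [hS, mem_sdiff, mem_filter, mem_range, mem_insert, mem_singleton, not_or, and_assoc]
  have hπS : ∀ y ∈ S, π y ∈ S := by
    intro y hy
    obtain ⟨h1, h2, h3, h4⟩ := hmem.mp hy
    refine hmem.mpr ⟨A.lt y h1, ?_, ?_, ?_⟩
    · rw [A.inv h1]; exact h2.symm
    · rintro rfl; exact h4 (A.inv h1).symm
    · intro h; apply h3; rw [← A.inv h1, h, A.inv hx]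
  have hcard : 2 * d ≤ #S + 2 := by
    rw [← A.card_moved]
    exact (card_le_card_sdiff_add_card (t := {x, π x})).trans (Nat.add_le_add_left card_le_two _)
  -- Summing `v y + v (π y)` over `S` counts every pair twice, which avoids choosing a
  -- representative cell.
  have hsum : ∑ y ∈ S, v (π y) = ∑ y ∈ S, v y := by
    apply sum_nbij' π π hπS hπS
    · intro y hy; exact A.inv (hmem.mp hy).1
    · intro y hy; exact A.inv (hmem.mp hy).1
    · intro y hy; rfl
  have hge : ∀ y ∈ S, 2 ≤ v y + v (π y) := by
    intro y hy
    obtain ⟨h1, h2, h3, h4⟩ := hmem.mp hy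
    obtain ⟨h5, h6, h7, h8⟩ := hmem.mp (hπS y hy)
    simp only [v, A.inv h1]
    rcases A.meet hx h1 hne h2 with h | h
    · by_cases h' : near x (π x) (π y) = true <;> simp [*, h2.symm]
    · by_cases h' : near x (π x) y = true <;> simp [*, h2.symm]
  have h1 : 2 * #S ≤ 2 * ∑ y ∈ S, v y := by
    calc 2 * #S = ∑ y ∈ S, 2 := by rw [sum_const, smul_eq_mul, mul_comm]
      _ ≤ ∑ y ∈ S, (v y + v (π y)) := sum_le_sum hge
      _ = 2 * ∑ y ∈ S, v y := by rw [sum_add_distrib, hsum, two_mul]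
  have h2 : ∑ y ∈ S, v y ≤ ∑ y ∈ range 42, v y :=
    sum_le_sum_of_subset fun y hy => mem_range.mpr (hmem.mp hy).1
  change 2 * d ≤ ∑ y ∈ range 42, v y + 2
  omega

/-- Each of the 20 near cells splits the amount 2 between `weight` and the summand of
`le_sum_near_moved`. The latter takes at least `2 * d - 2` of the total 40. -/
theorem sum_weight_le (A : Arrangement d u h D π) {x : ℕ} (hx : x < 42) (hne : π x ≠ x) :
    ∑ y ∈ range 42, weight π x y + 2 * d ≤ 42 := by
  have h1 := A.le_sum_near_moved hx hne
  have h2 := card_near hx (A.lt x hx) (A.apart hx hne)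
  have h3 : ∀ y ∈ range 42, weight π x y + (if y ≠ x ∧ y ≠ π x ∧ near x (π x) y = true ∧ π y ≠ y then
      (if near x (π x) (π y) = true then 1 else 2) else 0) =
      2 * (if y ≠ x ∧ y ≠ π x ∧ near x (π x) y then 1 else 0) := by
    intro y _
    unfold weight
    by_cases hn : y ≠ x ∧ y ≠ π x ∧ near x (π x) y = true
    · rw [if_pos hn]
      obtain ⟨hn1, hn2, hn3⟩ := hn
      by_cases hy : π y = y
      · rw [if_pos ⟨hn1, hn2, hn3, by rwa [hy]⟩, if_pos hy, if_neg fun h => h.2.2.2 hy]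
      · rw [if_pos (⟨hn1, hn2, hn3, hy⟩ : y ≠ x ∧ y ≠ π x ∧ near x (π x) y = true ∧ π y ≠ y)]
        by_cases hn' : near x (π x) (π y) = true
        · rw [if_pos ⟨hn1, hn2, hn3, hn'⟩, if_neg hy, if_pos hn']
        · rw [if_neg fun h => hn' h.2.2.2, if_neg hn']
    · rw [if_neg hn, if_neg fun h => hn ⟨h.1, h.2.1, h.2.2.1⟩,
        if_neg fun h => hn ⟨h.1, h.2.1, h.2.2.1⟩]
  have h4 := sum_congr rfl h3
  rw [sum_add_distrib, ← mul_sum, h2] at h4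
  omega

/-- `weight` is `pairWeight` plus 2 for each near fixed cell, and at least `u` fixed cells are near.
-/
theorem sum_pairWeight_le (A : Arrangement d u h D π) {x : ℕ} (hx : x < 42) (hne : π x ≠ x) :
    ∑ y ∈ range 42, pairWeight π x y + 2 * u + 2 * d ≤ 42 := by
  have h1 := A.sum_weight_le hx hne
  have h2 := A.le_sum_near_fixed hx hne
  have h3 : ∀ y ∈ range 42, weight π x y = pairWeight π x y +
      2 * (if π y = y ∧ near x (π x) y = true then 1 else 0) := by
    intro y _
    unfold weight pairWeight
    by_cases hy : π y = y
    · have h5 : y ≠ x := by rintro rfl; exact hne hy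
      have h6 : y ≠ π x := by rintro rfl; rw [A.inv hx] at hy; exact hne hy.symm
      by_cases hn : near x (π x) y = true <;> simp [hy, h5, h6, hn]
    · simp [hy]
  rw [sum_congr rfl h3, sum_add_distrib, ← mul_sum] at h1
  omega

theorem sum_farWeight_le (A : Arrangement d u h D π) {x : ℕ} (hx : x < 42) (hne : π x ≠ x) :
    ∑ y ∈ range 42, farWeight π x y + u + 2 * d ≤ 42 := by
  have h1 := A.sum_fixed
  have h2 := A.le_sum_near_fixed hx hne
  have h3 : ∀ y ∈ range 42, (if π y = y then 1 else 0) = farWeight π x y +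
      (if π y = y ∧ near x (π x) y = true then 1 else 0) := by
    intro y _
    unfold farWeight
    by_cases hy : π y = y
    · by_cases hn : near x (π x) y = true <;> simp [hy, hn]
    · simp [hy]
  rw [sum_congr rfl h3, sum_add_distrib] at h1
  omega

theorem sol (A : Arrangement d u h D π) : Sol d u π where
  lt := A.lt
  inv _ hx := A.inv hx
  apart _ hx := A.apart hx
  meet _ hx _ hy := A.meet hx hy
  total := by have := A.sum_fixed; omega
  row _ := A.sum_line_le fun _ _ hx hy => Or.inl (hx.trans hy.symm)
  col _ := A.sum_line_le fun _ _ hx hy => Or.inr (hx.trans hy.symm)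
  weight_le _ hx hne := by have := A.sum_weight_le hx hne; omega
  pairWeight_le _ hx hne := by have := A.sum_pairWeight_le hx hne; omega
  farWeight_le _ hx hne := by have := A.sum_farWeight_le hx hne; omega

theorem conj (A : Arrangement d u h D π) {g : Swap} (hg : g.Ok) :
    Arrangement d u (h ∘ g.perm) D (g.conj π) where
  card := A.card
  card_compl := A.card_compl
  surj c := by
    obtain ⟨x, hx, rfl⟩ := A.surj c
    exact ⟨g.perm x, hg.perm_lt hx, by simp [hg.perm_perm]⟩
  proper x hx y hy hne hxy := by
    have hne' : g.perm x ≠ g.perm y := fun h => hne (by rw [← hg.perm_perm x, h, hg.perm_perm])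
    have := A.proper _ (hg.perm_lt hx) _ (hg.perm_lt hy) hne' hxy
    rw [hg.perm_div, hg.perm_div, hg.perm_mod, hg.perm_mod] at this
    exact ⟨fun h => this.1 (by rw [h]), fun h => this.2 (by rw [h])⟩
  complete c c' hc := by
    obtain ⟨x, hx, y, hy, h1, h2, h3⟩ := A.complete c c' hc
    refine ⟨g.perm x, hg.perm_lt hx, g.perm y, hg.perm_lt hy, ?_, ?_, ?_⟩
    · simpa [hg.perm_perm] using h1
    · simpa [hg.perm_perm] using h2
    · rw [hg.perm_div, hg.perm_div, hg.perm_mod, hg.perm_mod]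
      exact h3.imp (fun h => by rw [h]) fun h => by rw [h]
  lt x hx := hg.perm_lt (A.lt _ (hg.perm_lt hx))
  pair x hx hD := by
    obtain ⟨h1, h2, h3⟩ := A.pair _ (hg.perm_lt hx) hD
    refine ⟨fun h => h1 ?_, ?_, fun y hy hyx => ?_⟩
    · rw [← hg.perm_perm (π (g.perm x))]; exact congrArg g.perm h
    · simpa [Swap.conj, hg.perm_perm] using h2
    · rcases h3 _ (hg.perm_lt hy) hyx with h | h
      · left; rw [← hg.perm_perm y, h, hg.perm_perm]
      · right; rw [← hg.perm_perm y, h]; rfl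
  fixed x hx hD := by
    rw [Swap.conj, A.fixed _ (hg.perm_lt hx) hD, hg.perm_perm]

/-- The symmetric property given to `run_sound` is that some colouring induces `π`. Swaps act on the
colouring, so the counting constraints need no separate invariance proof. -/
theorem not_of_run (A : Arrangement d u h D π) {m K : ℕ} (hK : 0 < K)
    (hr : ∀ i : Fin K, run d u m K i = true) : False :=
  run_sound (P := fun π => ∃ h : ℕ → C, Arrangement d u h D π) (fun _ ⟨_, A⟩ => A.sol)
    (fun _ hg _ ⟨_, A⟩ => ⟨_, A.conj hg⟩) hK hr π ⟨h, A⟩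

end Arrangement


/-! ### Sizes of the colour classes -/

theorem card_line {x : ℕ} (hx : x < 42) :
    #{y ∈ range 42 | y ≠ x ∧ (x / 7 = y / 7 ∨ x % 7 = y % 7)} = 11 := by
  have key : ∀ x < 42, #{y ∈ range 42 | y ≠ x ∧ (x / 7 = y / 7 ∨ x % 7 = y % 7)} = 11 := by
    decide +kernel
  exact key x hx

/-- A proper complete colouring of the cells `0, …, 41` of the `6 × 7` grid. -/
structure CellColoring {C : Type} (h : ℕ → C) : Prop where
  proper : ∀ x < 42, ∀ y < 42, x ≠ y → h x = h y → x / 7 ≠ y / 7 ∧ x % 7 ≠ y % 7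
  complete : ∀ c c', c ≠ c' → ∃ x < 42, ∃ y < 42, h x = c ∧ h y = c' ∧ (x / 7 = y / 7 ∨ x % 7 = y % 7)

namespace CellColoring

theorem surj {C : Type} [Fintype C] {h : ℕ → C} (H : CellColoring h) (hC : 1 < Fintype.card C) (c : C) : ∃ x < 42, h x = c := by
  obtain ⟨c', hc'⟩ := Fintype.exists_ne_of_one_lt_card hC c
  obtain ⟨x, hx, _, _, h1, _⟩ := H.complete c c' hc'.symm
  exact ⟨x, hx, h1⟩

variable {C : Type} [Fintype C] [DecidableEq C] {h : ℕ → C}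

theorem two_le_card (H : CellColoring h) (hC : 12 < Fintype.card C) (c : C) :
    2 ≤ #{x ∈ range 42 | h x = c} := by
  by_contra! hlt
  obtain ⟨x, hx, rfl⟩ := H.surj (by omega) c
  have huniq : ∀ y < 42, h y = h x → y = x := fun y hy hyx =>
    card_le_one.mp (Nat.le_of_lt_succ hlt) y (by simp [hy, hyx]) x (by simp [hx])
  have h1 : #({h x}ᶜ : Finset C) ≤ 11 := by
    rw [← card_line hx]
    refine (card_le_card fun c hc => ?_).trans (card_image_le (f := h))
    obtain ⟨z, hz, y, hy, h1, h2, h3⟩ := H.complete (h x) c fun hxc => by simp [hxc] at hc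
    rw [huniq z hz h1] at h3
    have hyx : y ≠ x := by
      rintro rfl
      simp [h2] at hc
    exact mem_image.mpr ⟨y, by simpa [hy, hyx] using h3, h2⟩
  rw [card_compl, card_singleton] at h1
  omega

theorem sum_card (h : ℕ → C) : ∑ c, #{x ∈ range 42 | h x = c} = 42 :=
  (card_eq_sum_card_fiberwise (fun _ _ => mem_coe.mpr (mem_univ _))).symm.trans (card_range 42)

theorem card_le (H : CellColoring h) (hC : 12 < Fintype.card C) : Fintype.card C ≤ 21 := by
  have h1 := sum_le_sum fun c (_ : c ∈ univ) => H.two_le_card hC c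
  rw [sum_card, sum_const, card_univ, smul_eq_mul] at h1
  omega

/-- A class of size 2 falls short of 3 by one, and every other class has size at least 3; summing
the sizes gives 42. -/
theorem le_card_two (H : CellColoring h) (hC : 12 < Fintype.card C) :
    3 * Fintype.card C ≤ #{c | #{x ∈ range 42 | h x = c} = 2} + 42 := by
  have h1 : ∀ c ∈ univ, 3 ≤ (if #{x ∈ range 42 | h x = c} = 2 then 1 else 0) +
      #{x ∈ range 42 | h x = c} := by
    intro c _
    have := H.two_le_card hC c
    split_ifs <;> omega
  have h2 := sum_le_sum h1
  rw [sum_add_distrib, sum_card, sum_const, card_univ, smul_eq_mul, ← card_filter] at h2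
  omega

theorem exists_arrangement (H : CellColoring h) {d u : ℕ} (hC : 12 < Fintype.card C)
    (hdu : Fintype.card C = d + u) (hd : d + 42 ≤ 3 * Fintype.card C) :
    ∃ D π, Arrangement d u h D π := by
  obtain ⟨D, hD, rfl⟩ := exists_subset_card_eq
    (show d ≤ #{c | #{x ∈ range 42 | h x = c} = 2} by have := H.le_card_two hC; omega)
  have hpair : ∀ x, ∃ y, x < 42 → y < 42 ∧
      (h x ∈ D → y ≠ x ∧ h y = h x ∧ ∀ z < 42, h z = h x → z = x ∨ z = y) ∧
      (h x ∉ D → y = x) := by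
    intro x
    by_cases hx : x < 42
    swap
    · exact ⟨x, fun h => absurd h hx⟩
    by_cases hxD : h x ∈ D
    swap
    · exact ⟨x, fun h => ⟨h, fun h' => absurd h' hxD, fun _ => rfl⟩⟩
    obtain ⟨a, b, hab, he⟩ := card_eq_two.mp (mem_filter.mp (hD hxD)).2
    have hmem : ∀ y, y < 42 ∧ h y = h x ↔ y = a ∨ y = b := fun y => by
      rw [← mem_range, ← mem_filter (p := fun y => h y = h x), he, mem_insert, mem_singleton]
    have ha := (hmem a).mpr (Or.inl rfl)
    have hb := (hmem b).mpr (Or.inr rfl)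
    rcases (hmem x).mp ⟨hx, rfl⟩ with rfl | rfl
    · exact ⟨b, fun _ => ⟨hb.1, fun _ => ⟨hab.symm, hb.2, fun z hz hzx => (hmem z).mp ⟨hz, hzx⟩⟩,
        fun h' => absurd hxD h'⟩⟩
    · exact ⟨a, fun _ => ⟨ha.1, fun _ => ⟨hab, ha.2, fun z hz hzx => ((hmem z).mp ⟨hz, hzx⟩).symm⟩,
        fun h' => absurd hxD h'⟩⟩
  choose π hπ using hpair
  exact ⟨D, π,
    { card := rfl
      card_compl := by rw [card_compl]; omega
      surj := H.surj (by omega)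
      proper := H.proper
      complete := H.complete
      lt := fun x hx => (hπ x hx).1
      pair := fun x hx => (hπ x hx).2.1
      fixed := fun x hx => (hπ x hx).2.2 }⟩

end CellColoring

end GridSearch

/-! ### From the product graph to the grid -/

open SimpleGraph in
theorem SimpleGraph.Coloring.cellColoring {k : ℕ}
    (f : (boxProd (completeGraph (Fin 6)) (completeGraph (Fin 7))).Coloring (Fin k))
    (hf : f.IsComplete) :
    GridSearch.CellColoring fun x => f (Fin.ofNat 6 (x / 7), Fin.ofNat 7 (x % 7)) where
  proper x hx y hy hne hxy := by
    constructor
    · intro h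
      refine f.valid (boxProd_adj.mpr (Or.inr ⟨fun h' => ?_, by rw [h]⟩)) hxy
      have := congrArg Fin.val h'
      simp only [Fin.val_ofNat] at this
      omega
    · intro h
      refine f.valid (boxProd_adj.mpr (Or.inl ⟨fun h' => ?_, by rw [h]⟩)) hxy
      have := congrArg Fin.val h'
      simp only [Fin.val_ofNat] at this
      omega
  complete c c' hc := by
    obtain ⟨v, w, hvw, rfl, rfl⟩ := hf c c' hc
    have key : ∀ v : Fin 6 × Fin 7, ∃ x : ℕ, x < 42 ∧ x / 7 = v.1 ∧ x % 7 = v.2 ∧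
        (Fin.ofNat 6 (x / 7), Fin.ofNat 7 (x % 7)) = v := by
      intro v
      have h1 := v.1.isLt
      have h2 := v.2.isLt
      refine ⟨7 * (v.1 : ℕ) + v.2, by omega, by omega, by omega, ?_⟩
      ext
      · simp only [Fin.val_ofNat]; omega
      · simp only [Fin.val_ofNat]; omega
    obtain ⟨x, hx, hx1, hx2, hxv⟩ := key v
    obtain ⟨y, hy, hy1, hy2, hyw⟩ := key w
    refine ⟨x, hx, y, hy, congrArg f hxv, congrArg f hyw, ?_⟩
    rw [hx1, hx2, hy1, hy2]
    rw [boxProd_adj] at hvw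
    rcases hvw with h | h
    · exact Or.inr (congrArg Fin.val h.2)
    · exact Or.inl (congrArg Fin.val h.2)

/-! ### The colouring with 18 colours -/

namespace GridSearch

/-- A proper complete colouring with 18 colours. -/
def grid : Fin 6 × Fin 7 → Fin 18 := fun v =>
  ![![0, 10, 14, 15, 6, 1, 16], ![10, 0, 13, 17, 5, 3, 12], ![5, 9, 16, 14, 4, 11, 15],
    ![8, 11, 12, 13, 7, 9, 17], ![4, 2, 17, 12, 1, 6, 13], ![2, 7, 15, 16, 3, 8, 14]] v.1 v.2

theorem grid_proper : ∀ v w : Fin 6 × Fin 7,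
    (v.1 ≠ w.1 ∧ v.2 = w.2 ∨ v.2 ≠ w.2 ∧ v.1 = w.1) → grid v ≠ grid w := by
  decide +kernel

theorem grid_complete : ∀ c c', c ≠ c' → ∃ v, grid v = c ∧ ∃ w, grid w = c' ∧
    (v.1 ≠ w.1 ∧ v.2 = w.2 ∨ v.2 ≠ w.2 ∧ v.1 = w.1) := by
  decide +kernel

end GridSearch

open SimpleGraph in
theorem hasCompleteColoring_eighteen :
    (boxProd (completeGraph (Fin 6)) (completeGraph (Fin 7))).HasCompleteColoring 18 := by
  refine ⟨Coloring.mk GridSearch.grid fun {v w} h => GridSearch.grid_proper v w ?_, ?_⟩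
  · rw [boxProd_adj] at h
    exact h
  · intro c c' hc
    obtain ⟨v, hv, w, hw, h⟩ := GridSearch.grid_complete c c' hc
    refine ⟨v, w, ?_, hv, hw⟩
    rw [boxProd_adj]
    exact h

/-! ### The searches and the conclusion -/

namespace GridSearch

set_option maxRecDepth 1000000 in
theorem run_eighteen_three : run 18 3 0 1 0 = true := by decide +kernel

set_option maxRecDepth 1000000 in
theorem run_eighteen_two : run 18 2 0 1 0 = true := by decide +kernel

set_option maxRecDepth 1000000 in
theorem run_fifteen_four_zero : run 15 4 6 6 0 = true := by decide +kernel

set_option maxRecDepth 1000000 in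
theorem run_fifteen_four_one : run 15 4 6 6 1 = true := by decide +kernel

set_option maxRecDepth 1000000 in
theorem run_fifteen_four_two : run 15 4 6 6 2 = true := by decide +kernel

set_option maxRecDepth 1000000 in
theorem run_fifteen_four_three : run 15 4 6 6 3 = true := by decide +kernel

set_option maxRecDepth 1000000 in
theorem run_fifteen_four_four : run 15 4 6 6 4 = true := by decide +kernel

set_option maxRecDepth 1000000 in
theorem run_fifteen_four_five : run 15 4 6 6 5 = true := by decide +kernel

theorem run_fifteen_four : ∀ i : Fin 6, run 15 4 6 6 i = true
  | 0 => run_fifteen_four_zero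
  | 1 => run_fifteen_four_one
  | 2 => run_fifteen_four_two
  | 3 => run_fifteen_four_three
  | 4 => run_fifteen_four_four
  | 5 => run_fifteen_four_five

theorem CellColoring.card_le_eighteen {C : Type} [Fintype C] [DecidableEq C] {h : ℕ → C}
    (H : CellColoring h) : Fintype.card C ≤ 18 := by
  by_contra! hlt
  have hle := H.card_le (by omega)
  have hcases : Fintype.card C = 19 ∨ Fintype.card C = 20 ∨ Fintype.card C = 21 := by omega
  rcases hcases with hC | hC | hC
  -- Here `15 = 3 * 19 - 42`; likewise `18 = 3 * 20 - 42` in the next case.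
  · obtain ⟨D, π, A⟩ := H.exists_arrangement (d := 15) (u := 4) (by omega) hC (by omega)
    exact A.not_of_run (by norm_num) run_fifteen_four
  · obtain ⟨D, π, A⟩ := H.exists_arrangement (d := 18) (u := 2) (by omega) hC (by omega)
    exact A.not_of_run (m := 0) (K := 1) (by norm_num) fun i => by
      rw [Subsingleton.elim i 0]; exact run_eighteen_two
  -- All 21 colours have two cells, but 18 pairs already give a contradiction; the other three
  -- colours are treated as unrestricted.
  · obtain ⟨D, π, A⟩ := H.exists_arrangement (d := 18) (u := 3) (by omega) hC (by omega)
    exact A.not_of_run (m := 0) (K := 1) (by norm_num) fun i => by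
      rw [Subsingleton.elim i 0]; exact run_eighteen_three

end GridSearch

theorem theorem1p3 :
    (SimpleGraph.boxProd (SimpleGraph.completeGraph (Fin 6))
      (SimpleGraph.completeGraph (Fin 7))).achromaticNumber = 18 := by
  refine (SimpleGraph.achromaticNumber_eq_iff _ (by norm_num)).mpr
    ⟨hasCompleteColoring_eighteen, fun k ⟨f, hf⟩ => ?_⟩
  simpa using (f.cellColoring hf).card_le_eighteen
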